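/- Let $\mathbb D\subset\mathbb C$ be the open unit disc, $d\mu=(1-|z|^2)^{-2}\,dA$ its hyperbolic measure ($dA$ Lebesgue measure), and for $\alpha>-1$ let $\mathbf B^2_\alpha$ be the space of holomorphic $f$ on $\mathbb D$ with $\|f\|^2:=\int_{\mathbb D}|f|^2(1-|z|^2)^{\alpha}\,dA<\infty$. Put $\mathbf f_\omega(z)=\sqrt{\tfrac{\alpha+1}{\pi}}\,(1-|\omega|^2)^{(\alpha+2)/2}(1-\overline\omega z)^{-(\alpha+2)}$ for $\omega\in\mathbb D$, $\theta_\alpha(s)=1-(1+\tfrac s\pi)^{-\alpha-1}$, and for $0\neq f\in\mathbf B_\alpha^2$ and measurable $\Omega\subset\mathbb D$ with $\mu(\Omega)=s\in(0,\infty)$, $$D_\alpha(f)=\inf_{|c|=\|f\|,\ \omega\in\mathbb D}\frac{\|f-c\,\mathbf f_\omega\|}{\|f\|},\qquad \delta(f;\Omega,\alpha)=\frac{\|f\|^2\theta_\alpha(s)-\int_\Omega|f|^2(1-|z|^2)^{\alpha+2}\,d\mu}{\|f\|^2\theta_\alpha(s)},$$ $$\mathcal A(\Omega)=\inf\Big\{\tfrac{\mu(\Omega\triangle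 B)}{\mu(\Omega)}: B\subset\mathbb D\text{ a pseudohyperbolic disc},\ \mu(B)=\mu(\Omega)\Big\},$$ $$\Sigma(c,\alpha)(s)=\Big(1+\tfrac{\alpha+2}{\alpha+1}\big[(1+c\tfrac s\pi)^{\alpha+1}-1\big]\Big)^{1/2},$$ where the square root is read as $0$ if the radicand is negative (which can happen only for $c<0$). The function and set stability estimates are $D_\alpha(f)\le C\,\Sigma(1,\alpha)(s)\,\delta(f;\Omega,\alpha)^{1/2}$, with $C$ absolute, and $\mathcal A(\Omega)\le K(s,\alpha)\,\delta(f;\Omega,\alpha)^{1/2}$. They are sharp in the following sense. (i) Let $\alpha>-1$, $\beta>\frac12$ and $s>0$. There is no constant $K$ such that $D_\alpha(f)\le K\,\delta(f;\Omega,\alpha)^\beta$ for all measurable $\Omega\subset\mathbb D$ with $\mu(\Omega)=s$ and all $0\ne f\in\mathbf B^2_\alpha$, and there is no constant $K$ such that $\mathcal A(\Omega)\le K\,\delta(f;\Omega,\alpha)^\beta$ for all such $\Omega$ and $f$. (ii) There are no $c<1$ and $C$ such that, for all sufficiently large $\alpha$, $D_\alpha(f)\le C\,\Sigma(c,\alpha)(s)\,\delta(f;\Omega,\alpha)^{1/2}$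 for all $s>0$, all measurable $\Omega\subset\mathbb D$ with $\mu(\Omega)=s$ and all $0\neq f\in\mathbf B^2_\alpha$. Moreover, for a given $\alpha>-1$, if this estimate holds (for all such $s,\Omega,f$) with some real $c$ and some $C>0$, then $$c\ \ge\ \Big(\frac{C^2(\alpha+2)}{2}\Big)^{-\frac1{\alpha+1}},$$ and if it holds with $C=1$, then also $c\ge\big(\frac{\pi(\alpha+2)}{\alpha+1}\big)^{-\frac{1}{\alpha+1}}$. (iii) Let $c_n=\int_{\mathbb D}|z|^{2n}(1-|z|^2)^\alpha\,dA$, let $f_{\alpha,\varepsilon}(z)=\frac1{\sqrt{c_0}}+\frac{\varepsilon}{\sqrt{c_2}}z^2$, a nonzero element of $\mathbf B^2_\alpha$, and let $B_s$ be the disc centred at $0$ of radius $\sqrt{s/(s+\pi)}$, so that $\mu(B_s)=s$. There are absolute constants $0<a\le b$ such that for every $s>0$ there is $\kappa(s)\in[a,b]$ with $$\frac{D_\alpha(f_{\alpha,\varepsilon})}{\varepsilon}\to1\qquad\text{and}\qquad\frac{\Sigma(1,\alpha)(s)\,\delta(f_{\alpha,\varepsilon};B_s,\alpha)^{1/2}}{\varepsilon}\to\kappa(s)$$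 as $(\alpha,\varepsilon)\to(-1,0)$ jointly with $\alpha>-1$, $\varepsilon>0$; that is, both sides of the function estimate behave like a constant times $\varepsilon$. -/

import Mathlib

open MeasureTheory Filter Set Topology

noncomputable section

namespace BergmanStability

/-- The open unit disc `𝔻`. -/
def disc : Set ℂ := Metric.ball 0 1

/-- The hyperbolic measure `dμ = (1 - |z|²)⁻² dA` on the unit disc, `dA` being Lebesgue measure. -/
def hypMeasure : Measure ℂ :=
  (volume.restrict disc).withDensity (fun z => ENNReal.ofReal (((1 - ‖z‖ ^ 2) ^ 2)⁻¹))

/-- Membership in the weighted Bergman space: holomorphic in the disc and square integrable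
with respect to `(1 - |z|²)^α dA`. -/
def MemBergman (α : ℝ) (f : ℂ → ℂ) : Prop :=
  DifferentiableOn ℂ f disc ∧
    IntegrableOn (fun z => ‖f z‖ ^ 2 * (1 - ‖z‖ ^ 2) ^ α) disc volume

/-- The weighted Bergman norm. -/
def bergmanNorm (α : ℝ) (f : ℂ → ℂ) : ℝ :=
  Real.sqrt (∫ z in disc, ‖f z‖ ^ 2 * (1 - ‖z‖ ^ 2) ^ α)

/-- The normalized reproducing kernel
`f_ω(z) = √((α+1)/π) (1-|ω|²)^((α+2)/2) (1 - ω̄ z)^(-(α+2))`. The principal branch is meant;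
`1 - ω̄ z` has positive real part for `z, ω` in the disc. -/
def kernelFun (α : ℝ) (ω z : ℂ) : ℂ :=
  ((Real.sqrt ((α + 1) / Real.pi) * (1 - ‖ω‖ ^ 2) ^ ((α + 2) / 2) : ℝ) : ℂ) /
    (1 - (starRingEnd ℂ) ω * z) ^ ((α + 2 : ℝ) : ℂ)

/-- `inf ‖f - c f_ω‖ / ‖f‖` over `|c| = ‖f‖` and `ω` in the disc. -/
def extremalDist (α : ℝ) (f : ℂ → ℂ) : ℝ :=
  sInf {d : ℝ | ∃ c ω : ℂ, ‖c‖ = bergmanNorm α f ∧ ω ∈ disc ∧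
    d = bergmanNorm α (fun z => f z - c * kernelFun α ω z) / bergmanNorm α f}

/-- `θ_α(s) = 1 - (1 + s/π)^(-α-1)`. -/
def theta (α s : ℝ) : ℝ := 1 - (1 + s / Real.pi) ^ (-α - 1)

/-- The deficit `δ(f; Ω, α)`. -/
def deficit (α : ℝ) (f : ℂ → ℂ) (Ω : Set ℂ) : ℝ :=
  (bergmanNorm α f ^ 2 * theta α (hypMeasure.real Ω)
      - ∫ z in Ω, ‖f z‖ ^ 2 * (1 - ‖z‖ ^ 2) ^ (α + 2) ∂hypMeasure) /
    (bergmanNorm α f ^ 2 * theta α (hypMeasure.real Ω))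

/-- The pseudohyperbolic disc with centre `x` and radius `r`. -/
def hypDisc (x : ℂ) (r : ℝ) : Set ℂ :=
  {z | z ∈ disc ∧ ‖z - x‖ < r * ‖1 - (starRingEnd ℂ) x * z‖}

/-- The hyperbolic asymmetry of `Ω`. -/
def asymmetry (Ω : Set ℂ) : ℝ :=
  sInf {d : ℝ | ∃ (x : ℂ) (r : ℝ), x ∈ disc ∧ hypMeasure (hypDisc x r) = hypMeasure Ω ∧
    d = hypMeasure.real (symmDiff Ω (hypDisc x r)) / hypMeasure.real Ω}

/-- The function estimate `inf ‖f - c f_ω‖ / ‖f‖ ≤ K δ(f; Ω, α)^β`, for all sets `Ω` of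
hyperbolic measure `s` and all nonzero `f` in the Bergman space. -/
def FunctionEstimate (α s K β : ℝ) : Prop :=
  ∀ Ω : Set ℂ, MeasurableSet Ω → Ω ⊆ disc → hypMeasure Ω = ENNReal.ofReal s →
    ∀ f : ℂ → ℂ, MemBergman α f → 0 < bergmanNorm α f →
      extremalDist α f ≤ K * deficit α f Ω ^ β

/-- The set estimate `𝒜(Ω) ≤ K δ(f; Ω, α)^β`, for all sets `Ω` of hyperbolic measure `s`
and all nonzero `f` in the Bergman space. -/
def SetEstimate (α s K β : ℝ) : Prop :=
  ∀ Ω : Set ℂ, MeasurableSet Ω → Ω ⊆ disc → hypMeasure Ω = ENNReal.ofReal s →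
    ∀ f : ℂ → ℂ, MemBergman α f → 0 < bergmanNorm α f →
      asymmetry Ω ≤ K * deficit α f Ω ^ β

/-- `Σ(c, α)` at the measure `s`; for `c = 1` it is the constant of the function estimate,
up to an absolute factor. -/
def sigmaConst (c α s : ℝ) : ℝ :=
  Real.sqrt (1 + (α + 2) / (α + 1) * ((1 + c * (s / Real.pi)) ^ (α + 1) - 1))

/-- `c_n = ‖zⁿ‖²` in the Bergman space. -/
def monomialConst (α : ℝ) (n : ℕ) : ℝ :=
  ∫ z in disc, ‖z‖ ^ (2 * n) * (1 - ‖z‖ ^ 2) ^ α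

/-- `f_{α,ε}(z) = 1/√c₀ + (ε/√c₂) z²`. -/
def testFun (α ε : ℝ) (z : ℂ) : ℂ :=
  ((1 / Real.sqrt (monomialConst α 0) : ℝ) : ℂ) +
    ((ε / Real.sqrt (monomialConst α 2) : ℝ) : ℂ) * z ^ 2

/-- The disc centred at the origin of hyperbolic measure `s`. -/
def centredDisc (s : ℝ) : Set ℂ := Metric.ball 0 (Real.sqrt (s / (s + Real.pi)))

end BergmanStability

end

open MeasureTheory Filter Set Topology

noncomputable section

namespace BergmanStability

/-! The sharpness claims rest on the functions `testFun α ε` and three kinds of sets: centred discs,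
ringed discs and deformed discs. Write u = (1 + s/π)⁻¹, γ² = (α+2)(α+3)/2 and N² = 1 + ε².

Distance. The two terms of `testFun` are orthonormal, so its norm is N. By the coefficient formula
its pairing with the kernel at ω is (1-|ω|²)^((α+2)/2) (1 + εγ ω̄²). For ε ≤ 1/2 this has modulus at
most 1 (`norm_pairing_le_one`), and it equals 1 at ω = 0. Hence D² = 2 - 2/N, which is asymptotic to
ε² and independent of α (`extremalDist_testFun`).

Exponents. On a centred disc the deficit is ε²/(1+ε²) times a factor depending only on u and α,
which rules out β > 1/2 in the function estimate. For the set estimate, take the constant extremal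
and move a ring of measure η across the boundary of the disc: the deficit is a second difference of
`theta`, of size O(η²), while the asymmetry is at least η/(2s), because half of the ring escapes any
competing disc (`le_asymmetry_ringedDisc`).

Constants. As s → ∞ the centred disc is not the best set for `testFun`. Perturbing 1/(1-r²) by the
factor 1 + b cos 2θ keeps the measure. With b = 2εγ/(α+2) the leading coefficient of the deficit
drops from ε²(α+1)(α+4)/2 to ε²(α+1)/2, up to o(ε²) (`leadingMass_le`). Since u^(α+1) Σ(c,α)² tends
to (α+2)/(α+1) c^(α+1), the estimate forces 1 ≤ C²(α+2)/2 · c^(α+1) (`one_le_of_estimate`), and for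
c < 1 this fails for large α. As s → 0, centred discs show that C = 1 is never admissible
(`not_estimate_one`), which settles the claim for C = 1 when α + 1 > 2π.

Limit α → -1. All quantities are explicit. The squared right-hand side divided by ε² tends to
`limitRatio u`, which lies in [1, 3]. -/

/-! ### Polar coordinates and star-shaped regions. -/

/-- The region bounded by the polar curve `r = ρ θ`. -/
def starRegion (ρ : ℝ → ℝ) : Set ℂ := {z | ‖z‖ < ρ (Complex.arg z)}

/-- The point with polar coordinates `(r, θ)`. -/
def polarPt (r θ : ℝ) : ℂ := r * (Real.cos θ + Real.sin θ * Complex.I)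

lemma polarPt_eq_symm (p : ℝ × ℝ) : Complex.polarCoord.symm p = polarPt p.1 p.2 := by
  rw [Complex.polarCoord_symm_apply]; rfl

lemma norm_polarPt {r : ℝ} (hr : 0 ≤ r) (θ : ℝ) : ‖polarPt r θ‖ = r := by
  have := Complex.norm_polarCoord_symm (r, θ)
  rw [polarPt_eq_symm] at this
  simpa [abs_of_nonneg hr] using this

lemma arg_polarPt {r θ : ℝ} (hr : 0 < r) (hθ : θ ∈ Ioo (-Real.pi) Real.pi) :
    Complex.arg (polarPt r θ) = θ := by
  unfold polarPt
  rw [Complex.ofReal_cos, Complex.ofReal_sin,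
    Complex.arg_mul_cos_add_sin_mul_I hr ⟨hθ.1, hθ.2.le⟩]

lemma continuous_polarPt : Continuous fun p : ℝ × ℝ => polarPt p.1 p.2 := by
  unfold polarPt; fun_prop

lemma measurableSet_starRegion {ρ : ℝ → ℝ} (hρ : Measurable ρ) : MeasurableSet (starRegion ρ) :=
  measurableSet_lt measurable_norm (hρ.comp Complex.measurable_arg)

lemma starRegion_const (R : ℝ) : starRegion (fun _ => R) = Metric.ball 0 R := by
  ext z; simp [starRegion]

lemma lintegral_starRegion {F : ℂ → ENNReal} (hF : Measurable F) {ρ : ℝ → ℝ}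
    (hρ : Measurable ρ) :
    ∫⁻ z in starRegion ρ, F z =
      ∫⁻ θ in Ioo (-Real.pi) Real.pi, ∫⁻ r in Ioo 0 (ρ θ),
        ENNReal.ofReal r * F (polarPt r θ) := by
  have hm : MeasurableSet {p : ℝ × ℝ | p.1 < ρ p.2} :=
    measurableSet_lt measurable_fst (hρ.comp measurable_snd)
  rw [← lintegral_indicator (measurableSet_starRegion hρ), ← Complex.lintegral_comp_polarCoord_symm,
    polarCoord_target]
  have h1 : ∀ p ∈ Ioi (0 : ℝ) ×ˢ Ioo (-Real.pi) Real.pi,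
      ENNReal.ofReal p.1 • (starRegion ρ).indicator F (Complex.polarCoord.symm p) =
        {p : ℝ × ℝ | p.1 < ρ p.2}.indicator
          (fun p => ENNReal.ofReal p.1 * F (polarPt p.1 p.2)) p := by
    rintro ⟨r, θ⟩ ⟨hr, hθ⟩
    have hr' : 0 < r := hr
    have : polarPt r θ ∈ starRegion ρ ↔ r < ρ θ := by
      simp only [starRegion, mem_ofPred_eq]
      rw [norm_polarPt hr'.le, arg_polarPt hr' hθ]
    rw [polarPt_eq_symm]
    by_cases h : r < ρ θ
    · simp [Set.indicator, this, h]
    · simp [Set.indicator, this, h]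
  rw [setLIntegral_congr_fun (measurableSet_Ioi.prod measurableSet_Ioo) h1]
  rw [Measure.volume_eq_prod, ← Measure.prod_restrict, lintegral_prod_symm]
  · refine lintegral_congr fun θ => ?_
    have : ∀ r : ℝ, {p : ℝ × ℝ | p.1 < ρ p.2}.indicator
          (fun p => ENNReal.ofReal p.1 * F (polarPt p.1 p.2)) (r, θ) =
          (Iio (ρ θ)).indicator (fun r => ENNReal.ofReal r * F (polarPt r θ)) r := by
      intro r; simp [Set.indicator]
    simp_rw [this]
    rw [lintegral_indicator measurableSet_Iio, Measure.restrict_restrict measurableSet_Iio,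
      Iio_inter_Ioi]
  · refine (Measurable.indicator ?_ hm).aemeasurable
    exact (measurable_fst.ennreal_ofReal).mul (hF.comp continuous_polarPt.measurable)

/-! ### Radial integrals of quadratics in r² against (1-r²)^α. -/

/-- The fundamental theorem of calculus for a nonnegative derivative, as a lower integral. -/
lemma lintegral_Ioo_of_hasDerivAt {G g : ℝ → ℝ} {a b : ℝ} (hab : a ≤ b)
    (hc : ContinuousOn G (Icc a b)) (hd : ∀ x ∈ Ioo a b, HasDerivAt G (g x) x)
    (hg : ∀ x ∈ Ioo a b, 0 ≤ g x) :
    ∫⁻ x in Ioo a b, ENNReal.ofReal (g x) = ENNReal.ofReal (G b - G a) := by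
  have hi := intervalIntegral.integrableOn_deriv_of_nonneg hc hd hg
  have h2 := intervalIntegral.integral_eq_sub_of_hasDerivAt_of_le hab hc hd
    ((intervalIntegrable_iff_integrableOn_Ioc_of_le hab).2 hi)
  rw [← h2, intervalIntegral.integral_of_le hab, integral_Ioc_eq_integral_Ioo,
    ofReal_integral_eq_lintegral_ofReal (hi.mono_set Ioo_subset_Ioc_self)]
  exact (ae_restrict_iff' measurableSet_Ioo).2 (ae_of_all _ hg)

/-- The primitive of `v ^ α * (A + B (1 - v) + C (1 - v) ^ 2)` vanishing at `0`. -/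
def radialPrim (α A B C v : ℝ) : ℝ :=
  (A + B + C) * (v ^ (α + 1) / (α + 1)) - (B + 2 * C) * (v ^ (α + 2) / (α + 2)) +
    C * (v ^ (α + 3) / (α + 3))

lemma continuous_radialPrim {α : ℝ} (hα : -1 < α) (A C : ℝ) :
    Continuous fun q : ℝ × ℝ => radialPrim α A q.1 C q.2 := by
  unfold radialPrim
  have h1 : Continuous fun q : ℝ × ℝ => q.2 ^ (α + 1) :=
    (Real.continuous_rpow_const (by linarith)).comp continuous_snd
  have h2 : Continuous fun q : ℝ × ℝ => q.2 ^ (α + 2) :=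
    (Real.continuous_rpow_const (by linarith)).comp continuous_snd
  have h3 : Continuous fun q : ℝ × ℝ => q.2 ^ (α + 3) :=
    (Real.continuous_rpow_const (by linarith)).comp continuous_snd
  fun_prop

lemma hasDerivAt_radialPrim {α : ℝ} (hα : -1 < α) (A B C : ℝ) {v : ℝ} (hv : 0 < v) :
    HasDerivAt (radialPrim α A B C) (v ^ α * (A + B * (1 - v) + C * (1 - v) ^ 2)) v := by
  have h (k : ℝ) (hk : 0 < α + k) :
      HasDerivAt (fun v : ℝ => v ^ (α + k) / (α + k)) (v ^ (α + k - 1)) v := by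
    have := (Real.hasDerivAt_rpow_const (x := v) (p := α + k) (Or.inl hv.ne')).div_const (α + k)
    refine this.congr_deriv ?_
    rw [mul_div_right_comm, div_self hk.ne', one_mul]
  have h1 := (h 1 (by linarith)).const_mul (A + B + C)
  have h2 := (h 2 (by linarith)).const_mul (B + 2 * C)
  have h3 := (h 3 (by linarith)).const_mul C
  have := (h1.sub h2).add h3
  refine this.congr_deriv ?_
  rw [show α + 1 - 1 = α by ring, show α + 2 - 1 = α + 1 by ring, show α + 3 - 1 = α + 2 by ring,
    Real.rpow_add hv, Real.rpow_add hv, Real.rpow_one, Real.rpow_two]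
  ring

/-- The substitution v = 1 - r² reduces this to `radialPrim`. For α < 0 and v = 0 the integrand may
be singular at the endpoint, so a lower integral is used with a primitive that is continuous on the
closed interval and differentiable only inside. -/
lemma lintegral_radial {α : ℝ} (hα : -1 < α) {A B C v : ℝ} (hv0 : 0 ≤ v) (hv1 : v ≤ 1)
    (hpos : ∀ r : ℝ, 0 ≤ A + B * r ^ 2 + C * r ^ 4) :
    ∫⁻ r in Ioo 0 (Real.sqrt (1 - v)),
        ENNReal.ofReal (r * ((A + B * r ^ 2 + C * r ^ 4) * (1 - r ^ 2) ^ α)) =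
      ENNReal.ofReal ((radialPrim α A B C 1 - radialPrim α A B C v) / 2) := by
  have hs : Real.sqrt (1 - v) ^ 2 = 1 - v := Real.sq_sqrt (by linarith)
  have hlt : ∀ r ∈ Ioo 0 (Real.sqrt (1 - v)), r ^ 2 < 1 := fun r hr => by
    have := pow_lt_pow_left₀ hr.2 hr.1.le two_ne_zero
    linarith
  rw [lintegral_Ioo_of_hasDerivAt (G := fun r => -(radialPrim α A B C (1 - r ^ 2) / 2))
    (Real.sqrt_nonneg _)]
  · congr 1
    simp only [hs]
    ring_nf
  · have := (continuous_radialPrim hα A C).comp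
      (by fun_prop : Continuous fun r : ℝ => ((B, 1 - r ^ 2) : ℝ × ℝ))
    exact (this.div_const 2).neg.continuousOn
  · intro r hr
    have h1 : HasDerivAt (fun r : ℝ => 1 - r ^ 2) (-(2 * r)) r := by
      simpa using (hasDerivAt_pow 2 r).const_sub 1
    have h2 := ((hasDerivAt_radialPrim hα A B C (by linarith [hlt r hr] : 0 < 1 - r ^ 2)).comp r
      h1).div_const 2 |>.neg
    refine h2.congr_deriv ?_
    ring
  · intro r hr
    exact mul_nonneg hr.1.le (mul_nonneg (hpos r)
      (Real.rpow_nonneg (by linarith [hlt r hr]) _))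

lemma radialPrim_le_one {α : ℝ} (hα : -1 < α) {A B C v : ℝ}
    (hpos : ∀ r : ℝ, 0 ≤ A + B * r ^ 2 + C * r ^ 4) (hv0 : 0 ≤ v) (hv1 : v ≤ 1) :
    radialPrim α A B C v ≤ radialPrim α A B C 1 := by
  have hmono : MonotoneOn (radialPrim α A B C) (Icc 0 1) := by
    refine monotoneOn_of_deriv_nonneg (convex_Icc 0 1) ?_ ?_ ?_
    · exact ((continuous_radialPrim hα A C).comp (by fun_prop :
        Continuous fun v : ℝ => ((B, v) : ℝ × ℝ))).continuousOn
    · rw [interior_Icc]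
      exact fun t ht =>
        (hasDerivAt_radialPrim hα _ _ _ ht.1).differentiableAt.differentiableWithinAt
    · rw [interior_Icc]
      intro t ht
      rw [(hasDerivAt_radialPrim hα _ _ _ ht.1).deriv]
      refine mul_nonneg (Real.rpow_nonneg ht.1.le _) ?_
      have := hpos (Real.sqrt (1 - t))
      rwa [show (Real.sqrt (1 - t)) ^ 4 = ((Real.sqrt (1 - t)) ^ 2) ^ 2 by ring,
        Real.sq_sqrt (by linarith [ht.2])] at this
  exact hmono ⟨hv0, hv1⟩ ⟨zero_le_one, le_rfl⟩ hv1

/-- Shows each ray of |x + y z²|² as a quadratic in r², with the angle entering only through the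
coefficient of r². -/
lemma norm_sq_quadratic_polarPt (x y r θ : ℝ) :
    ‖(x : ℂ) + y * polarPt r θ ^ 2‖ ^ 2 =
      x ^ 2 + 2 * x * y * Real.cos (2 * θ) * r ^ 2 + y ^ 2 * r ^ 4 := by
  have h : (x : ℂ) + y * polarPt r θ ^ 2 =
      ((x + y * r ^ 2 * Real.cos (2 * θ) : ℝ) : ℂ) +
        ((y * r ^ 2 * Real.sin (2 * θ) : ℝ) : ℂ) * Complex.I := by
    rw [Real.cos_two_mul, Real.sin_two_mul]
    have := Real.sin_sq_add_cos_sq θ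
    have h2 : (Real.sin θ : ℂ) ^ 2 = 1 - (Real.cos θ : ℂ) ^ 2 := by
      rw [eq_sub_iff_add_eq]; exact_mod_cast this
    unfold polarPt
    push_cast at h2 ⊢
    linear_combination (y * r ^ 2 : ℂ) * (Complex.sin θ) ^ 2 * Complex.I_sq - (y * r ^ 2 : ℂ) * h2
  rw [h, ← Complex.normSq_eq_norm_sq, Complex.normSq_add_mul_I]
  linear_combination (y * r ^ 2) ^ 2 * Real.sin_sq_add_cos_sq (2 * θ)

/-- Mass of `|x + y z²|²` over a star-shaped region with boundary `1 - r² = v θ`. -/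
lemma lintegral_quadratic_starRegion {α : ℝ} (hα : -1 < α) (x y : ℝ) {v : ℝ → ℝ}
    (hv : Continuous v) (hv0 : ∀ θ, 0 ≤ v θ) (hv1 : ∀ θ, v θ ≤ 1) :
    ∫⁻ z in starRegion (fun θ => Real.sqrt (1 - v θ)),
        ENNReal.ofReal (‖(x : ℂ) + y * z ^ 2‖ ^ 2 * (1 - ‖z‖ ^ 2) ^ α) =
      ENNReal.ofReal (∫ θ in (-Real.pi)..Real.pi,
        (radialPrim α (x ^ 2) (2 * x * y * Real.cos (2 * θ)) (y ^ 2) 1 -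
          radialPrim α (x ^ 2) (2 * x * y * Real.cos (2 * θ)) (y ^ 2) (v θ)) / 2) := by
  have hpos : ∀ θ r : ℝ,
      0 ≤ x ^ 2 + 2 * x * y * Real.cos (2 * θ) * r ^ 2 + y ^ 2 * r ^ 4 := fun θ r => by
    rw [← norm_sq_quadratic_polarPt]; positivity
  have hF : Measurable fun z : ℂ =>
      ENNReal.ofReal (‖(x : ℂ) + y * z ^ 2‖ ^ 2 * (1 - ‖z‖ ^ 2) ^ α) := by fun_prop
  rw [lintegral_starRegion hF (by fun_prop)]
  have h1 : ∀ θ : ℝ, ∫⁻ r in Ioo 0 (Real.sqrt (1 - v θ)), ENNReal.ofReal r *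
      ENNReal.ofReal (‖(x : ℂ) + y * polarPt r θ ^ 2‖ ^ 2 * (1 - ‖polarPt r θ‖ ^ 2) ^ α) =
      ENNReal.ofReal ((radialPrim α (x ^ 2) (2 * x * y * Real.cos (2 * θ)) (y ^ 2) 1 -
          radialPrim α (x ^ 2) (2 * x * y * Real.cos (2 * θ)) (y ^ 2) (v θ)) / 2) := by
    intro θ
    rw [← lintegral_radial hα (hv0 θ) (hv1 θ) (hpos θ)]
    refine setLIntegral_congr_fun measurableSet_Ioo fun r hr => ?_
    rw [← ENNReal.ofReal_mul hr.1.le, norm_polarPt hr.1.le, norm_sq_quadratic_polarPt]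
  simp_rw [h1]
  have hcont : Continuous fun θ =>
      (radialPrim α (x ^ 2) (2 * x * y * Real.cos (2 * θ)) (y ^ 2) 1 -
          radialPrim α (x ^ 2) (2 * x * y * Real.cos (2 * θ)) (y ^ 2) (v θ)) / 2 := by
    have hq := continuous_radialPrim hα (x ^ 2) (y ^ 2)
    refine Continuous.div_const (Continuous.sub ?_ ?_) 2
    · exact hq.comp (by fun_prop :
        Continuous fun θ : ℝ => ((2 * x * y * Real.cos (2 * θ), 1) : ℝ × ℝ))
    · exact hq.comp (by fun_prop :
        Continuous fun θ : ℝ => ((2 * x * y * Real.cos (2 * θ), v θ) : ℝ × ℝ))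
  have hpi : -Real.pi ≤ Real.pi := by linarith [Real.pi_pos]
  have hnn : ∀ θ : ℝ, 0 ≤ (radialPrim α (x ^ 2) (2 * x * y * Real.cos (2 * θ)) (y ^ 2) 1 -
          radialPrim α (x ^ 2) (2 * x * y * Real.cos (2 * θ)) (y ^ 2) (v θ)) / 2 := by
    intro θ
    linarith [radialPrim_le_one hα (hpos θ) (hv0 θ) (hv1 θ)]
  rw [intervalIntegral.integral_of_le hpi, integral_Ioc_eq_integral_Ioo,
    ofReal_integral_eq_lintegral_ofReal]
  · exact (hcont.integrableOn_Icc).mono_set Ioo_subset_Icc_self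
  · exact ae_of_all _ hnn

/-! ### Hyperbolic measure of star-shaped regions. -/

lemma sqrt_one_sub_le_one {v : ℝ} (h : 0 ≤ v) : Real.sqrt (1 - v) ≤ 1 := by
  exact Real.sqrt_le_one.2 (by linarith)

lemma starRegion_subset_disc {v : ℝ → ℝ} (hv0 : ∀ θ, 0 ≤ v θ) :
    starRegion (fun θ => Real.sqrt (1 - v θ)) ⊆ disc := fun z hz => by
  simp only [disc, Metric.mem_ball, dist_zero_right]
  exact lt_of_lt_of_le hz (sqrt_one_sub_le_one (hv0 _))

lemma measurable_hypDensity :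
    Measurable fun z : ℂ => ENNReal.ofReal (((1 - ‖z‖ ^ 2) ^ 2)⁻¹) := by fun_prop

lemma measurableSet_disc : MeasurableSet disc := Metric.isOpen_ball.measurableSet

lemma lintegral_hypMeasure {F : ℂ → ENNReal} (hF : Measurable F) :
    ∫⁻ z, F z ∂hypMeasure =
      ∫⁻ z in disc, ENNReal.ofReal (((1 - ‖z‖ ^ 2) ^ 2)⁻¹) * F z := by
  rw [hypMeasure, lintegral_withDensity_eq_lintegral_mul _ measurable_hypDensity hF]
  rfl

lemma hypMeasure_apply {Ω : Set ℂ} (hΩ : MeasurableSet Ω) (hd : Ω ⊆ disc) :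
    hypMeasure Ω = ∫⁻ z in Ω, ENNReal.ofReal (((1 - ‖z‖ ^ 2) ^ 2)⁻¹) := by
  rw [hypMeasure, withDensity_apply _ hΩ, Measure.restrict_restrict hΩ,
    inter_eq_self_of_subset_left hd]

/-- The radial density r/(1-r²)² has primitive 1/(2(1-r²)), so the measure is affine in the boundary
profile 1/v. -/
lemma hypMeasure_starRegion {v : ℝ → ℝ} (hv : Continuous v) (hv0 : ∀ θ, 0 < v θ)
    (hv1 : ∀ θ, v θ ≤ 1) :
    hypMeasure (starRegion fun θ => Real.sqrt (1 - v θ)) =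
      ENNReal.ofReal (∫ θ in (-Real.pi)..Real.pi, ((v θ)⁻¹ - 1) / 2) := by
  have hm : Measurable fun θ => Real.sqrt (1 - v θ) := by fun_prop
  rw [hypMeasure_apply (measurableSet_starRegion hm) (starRegion_subset_disc fun θ => (hv0 θ).le),
    lintegral_starRegion measurable_hypDensity hm]
  have h1 : ∀ θ : ℝ, ∫⁻ r in Ioo 0 (Real.sqrt (1 - v θ)), ENNReal.ofReal r *
      ENNReal.ofReal (((1 - ‖polarPt r θ‖ ^ 2) ^ 2)⁻¹) =
      ENNReal.ofReal (((v θ)⁻¹ - 1) / 2) := by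
    intro θ
    have hs : Real.sqrt (1 - v θ) ^ 2 = 1 - v θ := Real.sq_sqrt (by linarith [hv1 θ])
    have hlt : ∀ r ∈ Icc 0 (Real.sqrt (1 - v θ)), 0 < 1 - r ^ 2 := fun r hr => by
      have := pow_le_pow_left₀ hr.1 hr.2 2
      linarith [hv0 θ]
    have hd : ∀ r ∈ Icc 0 (Real.sqrt (1 - v θ)),
        HasDerivAt (fun r : ℝ => (1 - r ^ 2)⁻¹ / 2) (r * ((1 - r ^ 2) ^ 2)⁻¹) r := by
      intro r hr
      have h1 : HasDerivAt (fun r : ℝ => 1 - r ^ 2) (-(2 * r)) r := by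
        simpa using (hasDerivAt_pow 2 r).const_sub 1
      refine ((h1.inv (hlt r hr).ne').div_const 2).congr_deriv ?_
      field_simp
    have h2 := lintegral_Ioo_of_hasDerivAt (Real.sqrt_nonneg (1 - v θ))
      (fun r hr => (hd r hr).continuousAt.continuousWithinAt)
      (fun r hr => hd r (Ioo_subset_Icc_self hr))
      (fun r hr => mul_nonneg hr.1.le (by positivity))
    rw [show ((v θ)⁻¹ - 1) / 2 =
      (1 - Real.sqrt (1 - v θ) ^ 2)⁻¹ / 2 - (1 - (0 : ℝ) ^ 2)⁻¹ / 2 by rw [hs]; norm_num; ring, ← h2]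
    refine setLIntegral_congr_fun measurableSet_Ioo fun r hr => ?_
    rw [← ENNReal.ofReal_mul hr.1.le, norm_polarPt hr.1.le]
  simp_rw [h1]
  have hpi : -Real.pi ≤ Real.pi := by linarith [Real.pi_pos]
  have hcont : Continuous fun θ => ((v θ)⁻¹ - 1) / 2 :=
    ((hv.inv₀ fun θ => (hv0 θ).ne').sub continuous_const).div_const 2
  rw [intervalIntegral.integral_of_le hpi, integral_Ioc_eq_integral_Ioo,
    ofReal_integral_eq_lintegral_ofReal]
  · exact (hcont.integrableOn_Icc).mono_set Ioo_subset_Icc_self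
  · refine ae_of_all _ fun θ => ?_
    have := (one_le_inv₀ (hv0 θ)).2 (hv1 θ)
    simp only [Pi.zero_apply]
    linarith

/-! ### Masses over discs centred at the origin. -/

lemma radialPrim_eq_add (α A B C v : ℝ) :
    radialPrim α A B C v =
      radialPrim α A 0 C v + B * (v ^ (α + 1) / (α + 1) - v ^ (α + 2) / (α + 2)) := by
  unfold radialPrim; ring

lemma integral_cos_two_mul : ∫ θ in (-Real.pi)..Real.pi, Real.cos (2 * θ) = 0 := by
  rw [intervalIntegral.integral_comp_mul_left _ two_ne_zero, integral_cos]
  simp [Real.sin_two_pi]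

/-- The primitive is affine in its middle coefficient, and cos 2θ has mean zero; so the cross term
disappears whenever the radius does not depend on the angle. -/
lemma integral_radialPrim_cos (α A b C v : ℝ) :
    ∫ θ in (-Real.pi)..Real.pi, radialPrim α A (b * Real.cos (2 * θ)) C v =
      2 * Real.pi * radialPrim α A 0 C v := by
  simp_rw [radialPrim_eq_add α A (b * Real.cos _) C v]
  rw [intervalIntegral.integral_add (by simp) (by
    exact (by fun_prop : Continuous fun θ : ℝ => b * Real.cos (2 * θ) *
      (v ^ (α + 1) / (α + 1) - v ^ (α + 2) / (α + 2))).intervalIntegrable _ _),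
    intervalIntegral.integral_mul_const, intervalIntegral.integral_const_mul,
    integral_cos_two_mul, intervalIntegral.integral_const, smul_eq_mul]
  ring

lemma radialPrim_zero {α : ℝ} (hα : -1 < α) (A B C : ℝ) : radialPrim α A B C 0 = 0 := by
  unfold radialPrim
  rw [Real.zero_rpow (by linarith), Real.zero_rpow (by linarith), Real.zero_rpow (by linarith)]
  simp

lemma radialPrim_one {α : ℝ} (hα : -1 < α) (A C : ℝ) :
    radialPrim α A 0 C 1 = A / (α + 1) + 2 * C / ((α + 1) * (α + 2) * (α + 3)) := by
  have h1 : α + 1 ≠ 0 := by linarith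
  have h2 : α + 2 ≠ 0 := by linarith
  have h3 : α + 3 ≠ 0 := by linarith
  unfold radialPrim
  simp only [Real.one_rpow]
  field_simp
  ring

lemma lintegral_quadratic_ball {α : ℝ} (hα : -1 < α) (x y : ℝ) {v : ℝ} (hv0 : 0 ≤ v)
    (hv1 : v ≤ 1) :
    ∫⁻ z in Metric.ball (0 : ℂ) (Real.sqrt (1 - v)),
        ENNReal.ofReal (‖(x : ℂ) + y * z ^ 2‖ ^ 2 * (1 - ‖z‖ ^ 2) ^ α) =
      ENNReal.ofReal (Real.pi * (radialPrim α (x ^ 2) 0 (y ^ 2) 1 -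
        radialPrim α (x ^ 2) 0 (y ^ 2) v)) := by
  have h := lintegral_quadratic_starRegion hα x y (v := fun _ => v) continuous_const
    (fun _ => hv0) (fun _ => hv1)
  rw [starRegion_const] at h
  rw [h]
  have hi : ∀ t : ℝ, IntervalIntegrable
      (fun θ => radialPrim α (x ^ 2) (2 * x * y * Real.cos (2 * θ)) (y ^ 2) t) volume
      (-Real.pi) Real.pi := fun t =>
    ((continuous_radialPrim hα (x ^ 2) (y ^ 2)).comp (by fun_prop :
      Continuous fun θ : ℝ => ((2 * x * y * Real.cos (2 * θ), t) : ℝ × ℝ))).intervalIntegrable _ _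
  rw [intervalIntegral.integral_div, intervalIntegral.integral_sub (hi 1) (hi v),
    integral_radialPrim_cos, integral_radialPrim_cos]
  congr 1
  ring

lemma disc_eq_ball_sqrt : disc = Metric.ball (0 : ℂ) (Real.sqrt (1 - 0)) := by
  simp [disc]

lemma lintegral_quadratic_disc {α : ℝ} (hα : -1 < α) (x y : ℝ) :
    ∫⁻ z in disc, ENNReal.ofReal (‖(x : ℂ) + y * z ^ 2‖ ^ 2 * (1 - ‖z‖ ^ 2) ^ α) =
      ENNReal.ofReal (Real.pi * (x ^ 2 / (α + 1) +
        2 * y ^ 2 / ((α + 1) * (α + 2) * (α + 3)))) := by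
  rw [disc_eq_ball_sqrt, lintegral_quadratic_ball hα x y le_rfl zero_le_one, radialPrim_zero hα,
    radialPrim_one hα, sub_zero]

lemma centredDisc_eq {s : ℝ} (hs : 0 < s) :
    centredDisc s = Metric.ball 0 (Real.sqrt (1 - (1 + s / Real.pi)⁻¹)) := by
  have hp := Real.pi_pos
  have : s / (s + Real.pi) = 1 - (1 + s / Real.pi)⁻¹ := by field_simp; ring
  rw [centredDisc, this]

lemma hypMeasure_ball_sqrt {v : ℝ} (hv0 : 0 < v) (hv1 : v ≤ 1) :
    hypMeasure (Metric.ball 0 (Real.sqrt (1 - v))) = ENNReal.ofReal (Real.pi * (v⁻¹ - 1)) := by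
  have h := hypMeasure_starRegion (v := fun _ => v) continuous_const (fun _ => hv0) (fun _ => hv1)
  rw [starRegion_const] at h
  rw [h, intervalIntegral.integral_const, smul_eq_mul]
  congr 1
  ring

lemma hypMeasure_centredDisc {s : ℝ} (hs : 0 < s) :
    hypMeasure (centredDisc s) = ENNReal.ofReal s := by
  have hp := Real.pi_pos
  have h : 1 ≤ 1 + s / Real.pi := by
    have : 0 < s / Real.pi := by positivity
    linarith
  rw [centredDisc_eq hs, hypMeasure_ball_sqrt (by positivity) (inv_le_one_of_one_le₀ h), inv_inv]
  congr 1
  field_simp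
  ring

/-! ### Disc automorphisms and invariance of the hyperbolic measure. -/

/-- The disc automorphism `z ↦ (x - z) / (1 - x̄ z)`. -/
def moebius (x z : ℂ) : ℂ := (x - z) / (1 - (starRingEnd ℂ) x * z)

lemma mem_disc {z : ℂ} : z ∈ disc ↔ ‖z‖ < 1 := by simp [disc]

lemma one_sub_sq_pos {z : ℂ} (hz : z ∈ disc) : 0 < 1 - ‖z‖ ^ 2 := by
  have := mem_disc.1 hz
  nlinarith [norm_nonneg z]

/-- Places the base of the kernel in the right half-plane: it is nonzero, and its principal powers
are holomorphic. -/
lemma re_one_sub_conj_mul_pos {x z : ℂ} (hx : x ∈ disc) (hz : z ∈ disc) :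
    0 < (1 - (starRingEnd ℂ) x * z).re := by
  have h1 : ‖(starRingEnd ℂ) x * z‖ < 1 := by
    rw [norm_mul, RCLike.norm_conj]
    exact mul_lt_one_of_nonneg_of_lt_one_left (norm_nonneg _) (mem_disc.1 hx) (mem_disc.1 hz).le
  have h2 := Complex.re_le_norm ((starRingEnd ℂ) x * z)
  simp only [Complex.sub_re, Complex.one_re]
  linarith

lemma one_sub_conj_mul_ne_zero {x z : ℂ} (hx : x ∈ disc) (hz : z ∈ disc) :
    1 - (starRingEnd ℂ) x * z ≠ 0 := fun h => by
  have := re_one_sub_conj_mul_pos hx hz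
  rw [h] at this
  simp at this

lemma norm_sq_one_sub_conj_mul (x z : ℂ) :
    ‖1 - (starRingEnd ℂ) x * z‖ ^ 2 - ‖x - z‖ ^ 2 = (1 - ‖x‖ ^ 2) * (1 - ‖z‖ ^ 2) := by
  simp only [← Complex.normSq_eq_norm_sq, Complex.normSq_apply, Complex.sub_re, Complex.sub_im,
    Complex.mul_re, Complex.mul_im, Complex.conj_re, Complex.conj_im, Complex.one_re,
    Complex.one_im]
  ring

lemma one_sub_norm_moebius_sq {x z : ℂ} (hx : x ∈ disc) (hz : z ∈ disc) :
    1 - ‖moebius x z‖ ^ 2 =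
      (1 - ‖x‖ ^ 2) * (1 - ‖z‖ ^ 2) / ‖1 - (starRingEnd ℂ) x * z‖ ^ 2 := by
  have h : ‖1 - (starRingEnd ℂ) x * z‖ ≠ 0 := norm_ne_zero_iff.2 (one_sub_conj_mul_ne_zero hx hz)
  rw [← norm_sq_one_sub_conj_mul, moebius, norm_div, div_pow, sub_div, div_self (pow_ne_zero 2 h)]

lemma moebius_mem_disc {x z : ℂ} (hx : x ∈ disc) (hz : z ∈ disc) : moebius x z ∈ disc := by
  have h : 0 < 1 - ‖moebius x z‖ ^ 2 := by
    rw [one_sub_norm_moebius_sq hx hz]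
    have := norm_pos_iff.2 (one_sub_conj_mul_ne_zero hx hz)
    have := one_sub_sq_pos hx
    have := one_sub_sq_pos hz
    positivity
  rw [mem_disc]
  nlinarith [norm_nonneg (moebius x z)]

lemma moebius_moebius {x z : ℂ} (hx : x ∈ disc) (hz : z ∈ disc) :
    moebius x (moebius x z) = z := by
  have h1 := one_sub_conj_mul_ne_zero hx hz
  have h2 := one_sub_conj_mul_ne_zero hx (moebius_mem_disc hx hz)
  rw [moebius, div_eq_iff h2]
  have h3 : moebius x z * (1 - (starRingEnd ℂ) x * z) = x - z := div_mul_cancel₀ _ h1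
  linear_combination -h3

lemma hasDerivAt_moebius {x z : ℂ} (hx : x ∈ disc) (hz : z ∈ disc) :
    HasDerivAt (moebius x) (-(1 - (‖x‖ ^ 2 : ℝ)) / (1 - (starRingEnd ℂ) x * z) ^ 2) z := by
  have h1 : HasDerivAt (fun z => x - z) (-1) z := (hasDerivAt_id z).const_sub x
  have h2 : HasDerivAt (fun z => 1 - (starRingEnd ℂ) x * z) (-(starRingEnd ℂ) x) z := by
    simpa using ((hasDerivAt_id z).const_mul ((starRingEnd ℂ) x)).const_sub 1
  refine (h1.div h2 (one_sub_conj_mul_ne_zero hx hz)).congr_deriv ?_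
  congr 1
  have : (x * (starRingEnd ℂ) x) = ((‖x‖ ^ 2 : ℝ) : ℂ) := by
    rw [Complex.mul_conj, Complex.normSq_eq_norm_sq]
  linear_combination this

lemma det_restrictScalars_toSpanSingleton (d : ℂ) :
    ((ContinuousLinearMap.toSpanSingleton ℂ d).restrictScalars ℝ).det = ‖d‖ ^ 2 := by
  rw [ContinuousLinearMap.det]
  have : (((ContinuousLinearMap.toSpanSingleton ℂ d).restrictScalars ℝ : ℂ →L[ℝ] ℂ) :
      ℂ →ₗ[ℝ] ℂ) = ((LinearMap.toSpanSingleton ℂ ℂ d).restrictScalars ℝ) := rfl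
  rw [this, LinearMap.det_restrictScalars, Algebra.norm_complex_eq]
  simp [Complex.normSq_eq_norm_sq]

/-- The hyperbolic measure is invariant under disc automorphisms. -/
lemma lintegral_comp_moebius {F : ℂ → ENNReal} (hF : Measurable F) {x : ℂ} (hx : x ∈ disc) :
    ∫⁻ z, F (moebius x z) ∂hypMeasure = ∫⁻ z, F z ∂hypMeasure := by
  have hmeas : Measurable (moebius x) := by unfold moebius; fun_prop
  have himg : moebius x '' disc = disc := by
    refine Subset.antisymm (image_subset_iff.2 fun z hz => moebius_mem_disc hx hz) fun z hz => ?_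
    exact ⟨moebius x z, moebius_mem_disc hx hz, moebius_moebius hx hz⟩
  have hinj : InjOn (moebius x) disc := fun z hz w hw h => by
    rw [← moebius_moebius hx hz, h, moebius_moebius hx hw]
  rw [lintegral_hypMeasure hF, lintegral_hypMeasure (F := fun z => F (moebius x z)) (hF.comp hmeas)]
  conv_rhs => rw [← himg]
  rw [lintegral_image_eq_lintegral_abs_det_fderiv_mul volume measurableSet_disc
    (fun z hz => ((hasDerivAt_moebius hx hz).hasFDerivAt.restrictScalars ℝ).hasFDerivWithinAt)
    hinj]
  refine setLIntegral_congr_fun measurableSet_disc fun z hz => ?_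
  rw [← mul_assoc]
  congr 1
  -- The Jacobian is (1-|x|²)²/|1-x̄z|⁴, exactly the factor by which (1-|z|²)² changes under the
  -- automorphism.
  rw [det_restrictScalars_toSpanSingleton, ← ENNReal.ofReal_mul (abs_nonneg _),
    one_sub_norm_moebius_sq hx hz]
  congr 1
  have h1 := norm_pos_iff.2 (one_sub_conj_mul_ne_zero hx hz)
  have h2 := one_sub_sq_pos hx
  have h3 := one_sub_sq_pos hz
  have h4 : ‖-(1 - ((‖x‖ ^ 2 : ℝ) : ℂ))‖ = 1 - ‖x‖ ^ 2 := by
    rw [norm_neg, ← Complex.ofReal_one, ← Complex.ofReal_sub, Complex.norm_real,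
      Real.norm_of_nonneg h2.le]
  rw [abs_of_nonneg (sq_nonneg _), norm_div, norm_pow, h4]
  field_simp

lemma hypDisc_eq_preimage {x : ℂ} (hx : x ∈ disc) (r : ℝ) :
    hypDisc x r = disc ∩ moebius x ⁻¹' Metric.ball 0 r := by
  ext z
  simp only [hypDisc, mem_ofPred_eq, mem_inter_iff, mem_preimage, Metric.mem_ball,
    dist_zero_right]
  refine and_congr_right fun hz => ?_
  rw [moebius, norm_div, div_lt_iff₀ (norm_pos_iff.2 (one_sub_conj_mul_ne_zero hx hz)),
    norm_sub_rev]

lemma hypMeasure_disc_compl : hypMeasure discᶜ = 0 := by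
  rw [hypMeasure, withDensity_apply _ measurableSet_disc.compl,
    Measure.restrict_restrict measurableSet_disc.compl]
  simp

lemma hypMeasure_hypDisc {x : ℂ} (hx : x ∈ disc) (r : ℝ) :
    hypMeasure (hypDisc x r) = hypMeasure (Metric.ball 0 r) := by
  have hmeas : Measurable (moebius x) := by unfold moebius; fun_prop
  have h1 := lintegral_comp_moebius
    (F := (Metric.ball (0 : ℂ) r).indicator 1)
    (measurable_one.indicator Metric.isOpen_ball.measurableSet) hx
  rw [lintegral_indicator_one Metric.isOpen_ball.measurableSet] at h1
  have h2 : ∀ z, (Metric.ball (0 : ℂ) r).indicator (1 : ℂ → ENNReal) (moebius x z) =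
      (moebius x ⁻¹' Metric.ball 0 r).indicator 1 z := fun z => rfl
  simp_rw [h2] at h1
  rw [lintegral_indicator_one (hmeas Metric.isOpen_ball.measurableSet)] at h1
  rw [← h1, hypDisc_eq_preimage hx, inter_comm]
  exact measure_inter_conull hypMeasure_disc_compl

/-! ### The normalized kernels have norm one. -/

/-- Turns the weighted density of the kernel at ω into a radial function of `moebius ω z` against
hyperbolic measure; invariance of that measure then reduces the norm to the case ω = 0. -/
lemma norm_kernelFun_sq_mul {α : ℝ} (hα : -1 < α) {ω z : ℂ} (hω : ω ∈ disc) (hz : z ∈ disc) :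
    ‖kernelFun α ω z‖ ^ 2 * (1 - ‖z‖ ^ 2) ^ α =
      ((1 - ‖z‖ ^ 2) ^ 2)⁻¹ *
        ((α + 1) / Real.pi * (1 - ‖moebius ω z‖ ^ 2) ^ (α + 2)) := by
  have h1 := norm_pos_iff.2 (one_sub_conj_mul_ne_zero hω hz)
  have h2 := one_sub_sq_pos hω
  have h3 := one_sub_sq_pos hz
  have h4 : 0 ≤ (α + 1) / Real.pi := div_nonneg (by linarith) Real.pi_pos.le
  rw [one_sub_norm_moebius_sq hω hz, kernelFun, norm_div, Complex.norm_cpow_real,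
    Complex.norm_real, Real.norm_of_nonneg (by positivity), div_pow, mul_pow, Real.sq_sqrt h4,
    Real.div_rpow (by positivity) (by positivity), Real.mul_rpow h2.le h3.le,
    Real.rpow_add h3, Real.rpow_two, ← Real.rpow_mul_natCast h2.le,
    ← Real.rpow_mul_natCast h1.le, ← Real.rpow_natCast_mul h1.le]
  push_cast
  rw [div_mul_cancel₀ _ two_ne_zero, mul_comm (2 : ℝ) (α + 2)]
  field_simp

lemma lintegral_kernelFun {α : ℝ} (hα : -1 < α) {ω : ℂ} (hω : ω ∈ disc) :
    ∫⁻ z in disc, ENNReal.ofReal (‖kernelFun α ω z‖ ^ 2 * (1 - ‖z‖ ^ 2) ^ α) = 1 := by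
  have hp := Real.pi_pos
  have h4 : 0 ≤ (α + 1) / Real.pi := div_nonneg (by linarith) hp.le
  have hF : Measurable fun z : ℂ =>
      ENNReal.ofReal ((α + 1) / Real.pi * (1 - ‖z‖ ^ 2) ^ (α + 2)) := by fun_prop
  have hmeas : Measurable (moebius ω) := by unfold moebius; fun_prop
  have h1 : ∫⁻ z in disc, ENNReal.ofReal (‖kernelFun α ω z‖ ^ 2 * (1 - ‖z‖ ^ 2) ^ α) =
      ∫⁻ z, ENNReal.ofReal ((α + 1) / Real.pi * (1 - ‖moebius ω z‖ ^ 2) ^ (α + 2))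
        ∂hypMeasure := by
    rw [lintegral_hypMeasure (F := fun z => ENNReal.ofReal ((α + 1) / Real.pi *
      (1 - ‖moebius ω z‖ ^ 2) ^ (α + 2))) (hF.comp hmeas)]
    refine setLIntegral_congr_fun measurableSet_disc fun z hz => ?_
    rw [norm_kernelFun_sq_mul hα hω hz, ENNReal.ofReal_mul (by positivity)]
  rw [h1, lintegral_comp_moebius hF hω, lintegral_hypMeasure hF]
  have h2 := lintegral_quadratic_disc hα (Real.sqrt ((α + 1) / Real.pi)) 0
  have h3 : Real.pi * (Real.sqrt ((α + 1) / Real.pi) ^ 2 / (α + 1) +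
        2 * 0 ^ 2 / ((α + 1) * (α + 2) * (α + 3))) = 1 := by
    have : α + 1 ≠ 0 := by linarith
    rw [Real.sq_sqrt h4]
    field_simp
    simp
  rw [h3, ENNReal.ofReal_one] at h2
  rw [← h2]
  refine setLIntegral_congr_fun measurableSet_disc fun z hz => ?_
  have h5 := one_sub_sq_pos hz
  simp only [Complex.ofReal_zero, zero_mul, add_zero]
  rw [← ENNReal.ofReal_mul (by positivity), Complex.norm_real,
    Real.norm_of_nonneg (Real.sqrt_nonneg _), Real.sq_sqrt h4, Real.rpow_add h5, Real.rpow_two]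
  congr 1
  field_simp

/-! ### Pairing bounded holomorphic functions with monomials. -/

lemma polarPt_eq_circleMap (r θ : ℝ) : polarPt r θ = circleMap 0 r θ := by
  simp [polarPt, circleMap, Complex.exp_mul_I]

/-- On the circle of radius r one has z̄ = r²/z, so the integrand is r^(2n) times the Cauchy
integrand h/z^(n+1), up to the factor i. -/
lemma integral_conj_pow_mul_polarPt {h : ℂ → ℂ} (hh : DifferentiableOn ℂ h disc) (n : ℕ) {r : ℝ}
    (hr0 : 0 < r) (hr1 : r < 1) :
    ∫ θ in Ioo (-Real.pi) Real.pi, (starRingEnd ℂ) (polarPt r θ) ^ n * h (polarPt r θ) =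
      2 * Real.pi * (r : ℂ) ^ (2 * n) * (iteratedDeriv n h 0 / n.factorial) := by
  have hsub : Metric.closedBall (0 : ℂ) r ⊆ disc := Metric.closedBall_subset_ball hr1
  have hC := (hh.mono hsub).circleIntegral_one_div_sub_center_pow_smul hr0 n
  have hpi : -Real.pi ≤ Real.pi := by linarith [Real.pi_pos]
  have hper : Function.Periodic
      (fun θ : ℝ => (starRingEnd ℂ) (circleMap 0 r θ) ^ n * h (circleMap 0 r θ))
      (2 * Real.pi) := fun θ => by
    simp only [periodic_circleMap (0 : ℂ) r θ]
  rw [← integral_Ioc_eq_integral_Ioo, ← intervalIntegral.integral_of_le hpi]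
  simp_rw [polarPt_eq_circleMap]
  have h1 := hper.intervalIntegral_add_eq (-Real.pi) 0
  rw [show -Real.pi + 2 * Real.pi = Real.pi by ring, zero_add] at h1
  rw [h1]
  have h2 : ∀ θ : ℝ, (starRingEnd ℂ) (circleMap 0 r θ) ^ n * h (circleMap 0 r θ) =
      ((r : ℂ) ^ (2 * n) * Complex.I⁻¹) *
        (deriv (circleMap 0 r) θ • (1 / (circleMap 0 r θ - 0) ^ (n + 1)) •
          h (circleMap 0 r θ)) := by
    intro θ
    have hz : circleMap 0 r θ ≠ 0 := circleMap_ne_center hr0.ne'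
    have hcz : (starRingEnd ℂ) (circleMap 0 r θ) * circleMap 0 r θ = (r : ℂ) ^ 2 := by
      rw [mul_comm, Complex.mul_conj, Complex.normSq_eq_norm_sq, norm_circleMap_zero, sq_abs]
      push_cast; rfl
    have hI : Complex.I ≠ 0 := Complex.I_ne_zero
    rw [pow_mul, ← hcz, deriv_circleMap, smul_eq_mul, smul_eq_mul, sub_zero, mul_pow]
    field_simp
    ring
  simp_rw [h2]
  rw [intervalIntegral.integral_const_mul]
  have h3 : ∫ θ in (0 : ℝ)..2 * Real.pi, (deriv (circleMap 0 r) θ •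
      (1 / (circleMap 0 r θ - 0) ^ (n + 1)) • h (circleMap 0 r θ)) =
      2 * Real.pi * Complex.I / n.factorial * iteratedDeriv n h 0 := hC
  rw [h3]
  have hI : Complex.I ≠ 0 := Complex.I_ne_zero
  field_simp

lemma integral_disc_polar {G : ℂ → ℂ}
    (hG : IntegrableOn (fun p : ℝ × ℝ => p.1 • G (polarPt p.1 p.2))
      (Ioo 0 1 ×ˢ Ioo (-Real.pi) Real.pi)) :
    ∫ z in disc, G z =
      ∫ r in Ioo (0 : ℝ) 1, r • ∫ θ in Ioo (-Real.pi) Real.pi, G (polarPt r θ) := by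
  rw [← integral_indicator measurableSet_disc, ← Complex.integral_comp_polarCoord_symm,
    polarCoord_target]
  have h1 : ∀ p ∈ Ioi (0 : ℝ) ×ˢ Ioo (-Real.pi) Real.pi,
      p.1 • disc.indicator G (Complex.polarCoord.symm p) =
        (Iio (1 : ℝ) ×ˢ univ).indicator (fun p => p.1 • G (polarPt p.1 p.2)) p := by
    rintro ⟨r, θ⟩ ⟨hr, hθ⟩
    have hr' : 0 < r := hr
    have : polarPt r θ ∈ disc ↔ r < 1 := by rw [mem_disc, norm_polarPt hr'.le]
    rw [polarPt_eq_symm]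
    by_cases h : r < 1
    · simp [Set.indicator, this, h]
    · simp [Set.indicator, this, h]
  rw [setIntegral_congr_fun (measurableSet_Ioi.prod measurableSet_Ioo) h1,
    setIntegral_indicator (measurableSet_Iio.prod MeasurableSet.univ), prod_inter_prod,
    Ioi_inter_Iio, inter_univ, Measure.volume_eq_prod, setIntegral_prod _ hG]
  refine setIntegral_congr_fun measurableSet_Ioo fun r _ => ?_
  exact integral_smul _ _

lemma integrableOn_mul_rpow {α : ℝ} (hα : -1 < α) :
    IntegrableOn (fun r : ℝ => r * (1 - r ^ 2) ^ α) (Ioo 0 1) := by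
  have h := lintegral_radial hα (A := 1) (B := 0) (C := 0) le_rfl zero_le_one (by simp)
  simp only [sub_zero, Real.sqrt_one, zero_mul, add_zero, one_mul] at h
  refine ⟨by fun_prop, ?_⟩
  rw [hasFiniteIntegral_iff_ofReal, h]
  · exact ENNReal.ofReal_lt_top
  · refine (ae_restrict_iff' measurableSet_Ioo).2 (ae_of_all _ fun r hr => ?_)
    exact mul_nonneg hr.1.le (Real.rpow_nonneg (by nlinarith [hr.1, hr.2]) _)

lemma integrableOn_polar_of_bounded {α : ℝ} (hα : -1 < α) {h : ℂ → ℂ} (hc : ContinuousOn h disc)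
    {M : ℝ} (hM : ∀ z ∈ disc, ‖h z‖ ≤ M) :
    IntegrableOn (fun p : ℝ × ℝ => p.1 •
      (h (polarPt p.1 p.2) * (((1 - ‖polarPt p.1 p.2‖ ^ 2) ^ α : ℝ) : ℂ)))
      (Ioo 0 1 ×ˢ Ioo (-Real.pi) Real.pi) := by
  have hdom : IntegrableOn (fun p : ℝ × ℝ => (p.1 * (1 - p.1 ^ 2) ^ α) * M)
      (Ioo 0 1 ×ˢ Ioo (-Real.pi) Real.pi) := by
    have := (integrableOn_mul_rpow hα).mul_prod
      (integrableOn_const (μ := volume) (s := Ioo (-Real.pi) Real.pi) (C := M) (by simp))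
    rwa [Measure.prod_restrict] at this
  have hmem : ∀ p ∈ Ioo (0 : ℝ) 1 ×ˢ Ioo (-Real.pi) Real.pi, polarPt p.1 p.2 ∈ disc := by
    rintro ⟨r, θ⟩ ⟨hr, -⟩
    rw [mem_disc, norm_polarPt hr.1.le]
    exact hr.2
  refine Integrable.mono' hdom ?_ ?_
  · refine ContinuousOn.aestronglyMeasurable ?_ (measurableSet_Ioo.prod measurableSet_Ioo)
    refine continuousOn_fst.smul ((hc.comp continuous_polarPt.continuousOn hmem).mul ?_)
    refine Complex.continuous_ofReal.comp_continuousOn ?_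
    refine ContinuousOn.rpow_const ?_ fun p hp => Or.inl (one_sub_sq_pos (hmem p hp)).ne'
    exact (continuous_const.sub (continuous_polarPt.norm.pow 2)).continuousOn
  · refine (ae_restrict_iff' (measurableSet_Ioo.prod measurableSet_Ioo)).2 (ae_of_all _ ?_)
    rintro ⟨r, θ⟩ hp
    have hd := hmem _ hp
    have h1 := one_sub_sq_pos hd
    have hr : 0 < r := hp.1.1
    simp only [norm_smul, norm_mul, Complex.norm_real]
    simp only [norm_polarPt hr.le] at h1 ⊢
    rw [Real.norm_of_nonneg hr.le, Real.norm_of_nonneg (Real.rpow_nonneg h1.le _)]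
    have := hM _ hd
    have h2 := Real.rpow_nonneg h1.le α
    calc r * (‖h (polarPt r θ)‖ * (1 - r ^ 2) ^ α) ≤ r * (M * (1 - r ^ 2) ^ α) := by gcongr
      _ = _ := by ring

/-- The coefficient formula: pairing a bounded holomorphic function with a monomial. -/
lemma integral_conj_pow_mul {α : ℝ} (hα : -1 < α) {h : ℂ → ℂ} (hh : DifferentiableOn ℂ h disc)
    {M : ℝ} (hM : ∀ z ∈ disc, ‖h z‖ ≤ M) (n : ℕ) :
    ∫ z in disc, ((starRingEnd ℂ) z ^ n * h z) * (((1 - ‖z‖ ^ 2) ^ α : ℝ) : ℂ) =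
      monomialConst α n * (iteratedDeriv n h 0 / n.factorial) := by
  have hpow : ∀ z ∈ disc, ‖z‖ ^ n ≤ 1 := fun z hz =>
    pow_le_one₀ (norm_nonneg _) (mem_disc.1 hz).le
  have hintegral : ∀ {g : ℂ → ℂ}, DifferentiableOn ℂ g disc → (∃ M, ∀ z ∈ disc, ‖g z‖ ≤ M) →
      ∫ z in disc, ((starRingEnd ℂ) z ^ n * g z) * (((1 - ‖z‖ ^ 2) ^ α : ℝ) : ℂ) =
      (∫ r in Ioo (0 : ℝ) 1, ((r * (1 - r ^ 2) ^ α * r ^ (2 * n) : ℝ) : ℂ)) *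
        (2 * Real.pi * (iteratedDeriv n g 0 / n.factorial)) := by
    rintro g hg ⟨M, hM⟩
    have hcont : ContinuousOn (fun z => (starRingEnd ℂ) z ^ n * g z) disc :=
      (Complex.continuous_conj.pow n).continuousOn.mul hg.continuousOn
    have hbd : ∀ z ∈ disc, ‖(starRingEnd ℂ) z ^ n * g z‖ ≤ M := fun z hz => by
      rw [norm_mul, norm_pow, RCLike.norm_conj]
      exact (mul_le_of_le_one_left (norm_nonneg _) (hpow z hz)).trans (hM z hz)
    have hi₀ := integrableOn_polar_of_bounded hα hcont hbd
    have hi := integral_disc_polar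
      (G := fun z => ((starRingEnd ℂ) z ^ n * g z) * (((1 - ‖z‖ ^ 2) ^ α : ℝ) : ℂ)) hi₀
    rw [hi, ← integral_mul_const]
    refine setIntegral_congr_fun measurableSet_Ioo fun r hr => ?_
    have hr' : ∀ θ, ‖polarPt r θ‖ = r := norm_polarPt hr.1.le
    simp_rw [hr']
    rw [integral_mul_const, integral_conj_pow_mul_polarPt hg n hr.1 hr.2, Complex.real_smul]
    push_cast
    ring
  -- Applied to zⁿ itself, the formula identifies the radial integral with c_n/(2π), so it need not
  -- be evaluated.
  have hz := hintegral (g := fun z => z ^ n) (by fun_prop) ⟨1, fun z hz => by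
    rw [norm_pow]; exact hpow z hz⟩
  have hd : iteratedDeriv n (fun z : ℂ => z ^ n) 0 = n.factorial := by
    simp [Nat.descFactorial_self]
  have hm : ∫ z in disc, ((starRingEnd ℂ) z ^ n * z ^ n) * (((1 - ‖z‖ ^ 2) ^ α : ℝ) : ℂ) =
      monomialConst α n := by
    rw [monomialConst, ← integral_complex_ofReal]
    congr 1
    ext z
    rw [← mul_pow, mul_comm ((starRingEnd ℂ) z), Complex.mul_conj, Complex.normSq_eq_norm_sq,
      pow_mul]
    push_cast
    rfl
  rw [hm, hd, div_self (Nat.cast_ne_zero.2 n.factorial_ne_zero), mul_one] at hz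
  rw [hintegral hh ⟨M, hM⟩, hz]
  ring

/-! ### Holomorphy, boundedness and Taylor coefficients of the kernels. -/

lemma kernelFun_eq (α : ℝ) (ω z : ℂ) :
    kernelFun α ω z =
      ((Real.sqrt ((α + 1) / Real.pi) * (1 - ‖ω‖ ^ 2) ^ ((α + 2) / 2) : ℝ) : ℂ) *
        (1 - (starRingEnd ℂ) ω * z) ^ (-((α + 2 : ℝ) : ℂ)) := by
  rw [kernelFun, Complex.cpow_neg, div_eq_mul_inv]

lemma hasDerivAt_one_sub_mul_cpow {ω z : ℂ} (hω : ω ∈ disc) (hz : z ∈ disc) (b : ℂ) :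
    HasDerivAt (fun z => (1 - (starRingEnd ℂ) ω * z) ^ (-b))
      (b * (starRingEnd ℂ) ω * (1 - (starRingEnd ℂ) ω * z) ^ (-(b + 1))) z := by
  have h2 : HasDerivAt (fun z => 1 - (starRingEnd ℂ) ω * z) (-(starRingEnd ℂ) ω) z := by
    simpa using ((hasDerivAt_id z).const_mul ((starRingEnd ℂ) ω)).const_sub 1
  refine (h2.cpow_const (c := -b) (Or.inl (re_one_sub_conj_mul_pos hω hz))).congr_deriv ?_
  rw [show -(b + 1) = -b - 1 by ring]
  ring

lemma zero_mem_disc : (0 : ℂ) ∈ disc := by simp [disc]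

lemma disc_mem_nhds {z : ℂ} (hz : z ∈ disc) : disc ∈ 𝓝 z := Metric.isOpen_ball.mem_nhds hz

lemma differentiableOn_kernelFun {α : ℝ} {ω : ℂ} (hω : ω ∈ disc) :
    DifferentiableOn ℂ (kernelFun α ω) disc := by
  refine DifferentiableOn.congr ?_ fun z _ => kernelFun_eq α ω z
  exact fun z hz => ((hasDerivAt_one_sub_mul_cpow hω hz _).const_mul
    _).differentiableAt.differentiableWithinAt

lemma iteratedDeriv_two_kernelFun {α : ℝ} {ω : ℂ} (hω : ω ∈ disc) :
    iteratedDeriv 2 (kernelFun α ω) 0 =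
      ((Real.sqrt ((α + 1) / Real.pi) * (1 - ‖ω‖ ^ 2) ^ ((α + 2) / 2) : ℝ) : ℂ) *
        (((α + 2) * (α + 3) : ℝ) * (starRingEnd ℂ) ω ^ 2) := by
  set K : ℂ := ((Real.sqrt ((α + 1) / Real.pi) * (1 - ‖ω‖ ^ 2) ^ ((α + 2) / 2) : ℝ) : ℂ)
  have h1 : ∀ z ∈ disc, deriv (kernelFun α ω) z = K * (((α + 2 : ℝ) : ℂ) * (starRingEnd ℂ) ω *
      (1 - (starRingEnd ℂ) ω * z) ^ (-(((α + 2 : ℝ) : ℂ) + 1))) := by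
    intro z hz
    have he : kernelFun α ω =ᶠ[𝓝 z]
        fun z => K * (1 - (starRingEnd ℂ) ω * z) ^ (-((α + 2 : ℝ) : ℂ)) :=
      Eventually.of_forall fun w => kernelFun_eq α ω w
    rw [he.deriv_eq]
    exact ((hasDerivAt_one_sub_mul_cpow hω hz _).const_mul K).deriv
  rw [iteratedDeriv_succ, iteratedDeriv_one]
  have he : deriv (kernelFun α ω) =ᶠ[𝓝 0] fun z => K * (((α + 2 : ℝ) : ℂ) * (starRingEnd ℂ) ω *
      (1 - (starRingEnd ℂ) ω * z) ^ (-(((α + 2 : ℝ) : ℂ) + 1))) :=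
    eventually_of_mem (disc_mem_nhds zero_mem_disc) h1
  rw [he.deriv_eq, (((hasDerivAt_one_sub_mul_cpow hω zero_mem_disc _).const_mul
    (((α + 2 : ℝ) : ℂ) * (starRingEnd ℂ) ω)).const_mul K).deriv]
  simp only [mul_zero, sub_zero, Complex.one_cpow]
  push_cast
  ring

lemma norm_kernelFun_le {α : ℝ} (hα : -1 < α) {ω : ℂ} (hω : ω ∈ disc) :
    ∃ M, ∀ z ∈ disc, ‖kernelFun α ω z‖ ≤ M := by
  have h0 := mem_disc.1 hω
  refine ⟨Real.sqrt ((α + 1) / Real.pi) * (1 - ‖ω‖ ^ 2) ^ ((α + 2) / 2) /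
    (1 - ‖ω‖) ^ (α + 2), fun z hz => ?_⟩
  have h2 := one_sub_sq_pos hω
  have h3 : 0 < 1 - ‖ω‖ := by linarith
  rw [kernelFun, norm_div, Complex.norm_cpow_real, Complex.norm_real,
    Real.norm_of_nonneg (by positivity)]
  have h4 : 1 - ‖ω‖ ≤ ‖1 - (starRingEnd ℂ) ω * z‖ := by
    have h5 := norm_sub_norm_le (1 : ℂ) ((starRingEnd ℂ) ω * z)
    rw [norm_one, norm_mul, RCLike.norm_conj] at h5
    have := mul_le_of_le_one_right (norm_nonneg ω) (mem_disc.1 hz).le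
    linarith
  have : (0 : ℝ) ≤ α + 2 := by linarith
  gcongr

/-! ### Norms of monomials, kernels and test functions. -/

lemma integrableOn_and_integral_eq_of_lintegral {F : ℂ → ℝ} {S : Set ℂ} (hS : MeasurableSet S) (hF : Measurable F)
    (h0 : ∀ z ∈ S, 0 ≤ F z) {I : ℝ} (hI : 0 ≤ I)
    (h : ∫⁻ z in S, ENNReal.ofReal (F z) = ENNReal.ofReal I) :
    IntegrableOn F S ∧ ∫ z in S, F z = I := by
  have hae : 0 ≤ᵐ[volume.restrict S] F := (ae_restrict_iff' hS).2 (ae_of_all _ h0)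
  refine ⟨⟨hF.aestronglyMeasurable, ?_⟩, ?_⟩
  · rw [hasFiniteIntegral_iff_ofReal hae, h]
    exact ENNReal.ofReal_lt_top
  · rw [integral_eq_lintegral_of_nonneg_ae hae hF.aestronglyMeasurable, h,
      ENNReal.toReal_ofReal hI]

lemma weighted_nonneg (α : ℝ) (f : ℂ → ℂ) {z : ℂ} (hz : z ∈ disc) :
    0 ≤ ‖f z‖ ^ 2 * (1 - ‖z‖ ^ 2) ^ α :=
  mul_nonneg (sq_nonneg _) (Real.rpow_nonneg (one_sub_sq_pos hz).le _)

lemma bergmanNorm_sq (α : ℝ) (f : ℂ → ℂ) :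
    bergmanNorm α f ^ 2 = ∫ z in disc, ‖f z‖ ^ 2 * (1 - ‖z‖ ^ 2) ^ α :=
  Real.sq_sqrt (setIntegral_nonneg measurableSet_disc fun _ hz => weighted_nonneg α f hz)

lemma quadratic_disc {α : ℝ} (hα : -1 < α) (x y : ℝ) :
    IntegrableOn (fun z : ℂ => ‖(x : ℂ) + y * z ^ 2‖ ^ 2 * (1 - ‖z‖ ^ 2) ^ α) disc ∧
      ∫ z in disc, ‖(x : ℂ) + y * z ^ 2‖ ^ 2 * (1 - ‖z‖ ^ 2) ^ α =
        Real.pi * (x ^ 2 / (α + 1) + 2 * y ^ 2 / ((α + 1) * (α + 2) * (α + 3))) := by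
  have h1 : 0 < α + 1 := by linarith
  have h2 : 0 < α + 2 := by linarith
  have h3 : 0 < α + 3 := by linarith
  have := Real.pi_pos
  exact integrableOn_and_integral_eq_of_lintegral measurableSet_disc (by fun_prop)
    (fun z hz => weighted_nonneg α (fun z => (x : ℂ) + y * z ^ 2) hz) (by positivity)
    (lintegral_quadratic_disc hα x y)

lemma monomialConst_zero {α : ℝ} (hα : -1 < α) : monomialConst α 0 = Real.pi / (α + 1) := by
  have := (quadratic_disc hα 1 0).2
  rw [monomialConst]
  simpa [div_eq_mul_inv] using this

lemma monomialConst_two {α : ℝ} (hα : -1 < α) :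
    monomialConst α 2 = 2 * Real.pi / ((α + 1) * (α + 2) * (α + 3)) := by
  have := (quadratic_disc hα 0 1).2
  rw [monomialConst]
  have h2 : ∀ z : ℂ, ‖z‖ ^ (2 * 2) = ‖((0 : ℝ) : ℂ) + ((1 : ℝ) : ℂ) * z ^ 2‖ ^ 2 := fun z => by
    simp only [Complex.ofReal_zero, Complex.ofReal_one, zero_add, one_mul, norm_pow]
    ring
  simp_rw [h2, this]
  ring

lemma monomialConst_zero_pos {α : ℝ} (hα : -1 < α) : 0 < monomialConst α 0 := by
  rw [monomialConst_zero hα]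
  exact div_pos Real.pi_pos (by linarith)

lemma monomialConst_two_pos {α : ℝ} (hα : -1 < α) : 0 < monomialConst α 2 := by
  rw [monomialConst_two hα]
  have h1 : 0 < α + 1 := by linarith
  have h2 : 0 < α + 2 := by linarith
  have h3 : 0 < α + 3 := by linarith
  have := Real.pi_pos
  positivity

lemma kernel_disc {α : ℝ} (hα : -1 < α) {ω : ℂ} (hω : ω ∈ disc) :
    IntegrableOn (fun z : ℂ => ‖kernelFun α ω z‖ ^ 2 * (1 - ‖z‖ ^ 2) ^ α) disc ∧
      ∫ z in disc, ‖kernelFun α ω z‖ ^ 2 * (1 - ‖z‖ ^ 2) ^ α = 1 := by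
  refine integrableOn_and_integral_eq_of_lintegral measurableSet_disc ?_
    (fun z hz => weighted_nonneg α (kernelFun α ω) hz) zero_le_one
    (by rw [ENNReal.ofReal_one]; exact lintegral_kernelFun hα hω)
  unfold kernelFun
  fun_prop

lemma testFun_sq_coeffs {α : ℝ} (hα : -1 < α) (ε : ℝ) :
    (1 / Real.sqrt (monomialConst α 0)) ^ 2 = (α + 1) / Real.pi ∧
    (ε / Real.sqrt (monomialConst α 2)) ^ 2 =
      ε ^ 2 * ((α + 1) * (α + 2) * (α + 3)) / (2 * Real.pi) := by
  rw [div_pow, div_pow, Real.sq_sqrt (monomialConst_zero_pos hα).le,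
    Real.sq_sqrt (monomialConst_two_pos hα).le, monomialConst_zero hα, monomialConst_two hα]
  constructor
  · rw [one_pow, one_div_div]
  · rw [div_div_eq_mul_div]

lemma integrableOn_testFun {α : ℝ} (hα : -1 < α) (ε : ℝ) :
    IntegrableOn (fun z : ℂ => ‖testFun α ε z‖ ^ 2 * (1 - ‖z‖ ^ 2) ^ α) disc :=
  (quadratic_disc hα _ _).1

lemma bergmanNorm_testFun_sq {α : ℝ} (hα : -1 < α) (ε : ℝ) :
    bergmanNorm α (testFun α ε) ^ 2 = 1 + ε ^ 2 := by
  rw [bergmanNorm_sq]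
  unfold testFun
  rw [(quadratic_disc hα _ _).2, (testFun_sq_coeffs hα ε).1, (testFun_sq_coeffs hα ε).2]
  have h1 : α + 1 ≠ 0 := by linarith
  have h2 : α + 2 ≠ 0 := by linarith
  have h3 : α + 3 ≠ 0 := by linarith
  have := Real.pi_pos
  field_simp

lemma bergmanNorm_testFun {α : ℝ} (hα : -1 < α) (ε : ℝ) :
    bergmanNorm α (testFun α ε) = Real.sqrt (1 + ε ^ 2) := by
  rw [← bergmanNorm_testFun_sq hα ε]
  exact (Real.sqrt_sq (Real.sqrt_nonneg _)).symm

lemma bergmanNorm_testFun_pos {α : ℝ} (hα : -1 < α) (ε : ℝ) :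
    0 < bergmanNorm α (testFun α ε) := by
  rw [bergmanNorm_testFun hα]
  positivity

lemma memBergman_testFun {α : ℝ} (hα : -1 < α) (ε : ℝ) : MemBergman α (testFun α ε) := by
  refine ⟨?_, integrableOn_testFun hα ε⟩
  unfold testFun
  fun_prop

/-! ### The distance from the test function to the kernels. -/

/-- Pairing of the test function with the normalized kernel. -/
lemma integral_conj_testFun_mul_kernelFun {α : ℝ} (hα : -1 < α) (ε : ℝ) {ω : ℂ} (hω : ω ∈ disc) :
    ∫ z in disc, ((starRingEnd ℂ) (testFun α ε z) * kernelFun α ω z) *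
        (((1 - ‖z‖ ^ 2) ^ α : ℝ) : ℂ) =
      (((1 - ‖ω‖ ^ 2) ^ ((α + 2) / 2) : ℝ) : ℂ) *
        (1 + (ε * Real.sqrt ((α + 2) * (α + 3) / 2) : ℝ) * (starRingEnd ℂ) ω ^ 2) := by
  obtain ⟨M, hM⟩ := norm_kernelFun_le hα hω
  have hd := differentiableOn_kernelFun (α := α) hω
  have h0 := integral_conj_pow_mul hα hd hM 0
  have h2 := integral_conj_pow_mul hα hd hM 2
  have hk0 : kernelFun α ω 0 =
      ((Real.sqrt ((α + 1) / Real.pi) * (1 - ‖ω‖ ^ 2) ^ ((α + 2) / 2) : ℝ) : ℂ) := by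
    rw [kernelFun_eq α ω 0]; simp
  have hi : ∀ n : ℕ, IntegrableOn (fun z => ((starRingEnd ℂ) z ^ n * kernelFun α ω z) *
        (((1 - ‖z‖ ^ 2) ^ α : ℝ) : ℂ)) disc := by
    intro n
    have hw : IntegrableOn (fun z : ℂ => M * (1 - ‖z‖ ^ 2) ^ α) disc := by
      have := (quadratic_disc hα 1 0).1.const_mul M
      simp only [Complex.ofReal_one, Complex.ofReal_zero, zero_mul, add_zero, norm_one, one_pow,
        one_mul] at this
      exact this
    refine Integrable.mono' hw ?_ ?_
    · refine Measurable.aestronglyMeasurable ?_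
      unfold kernelFun
      fun_prop
    · refine (ae_restrict_iff' measurableSet_disc).2 (ae_of_all _ fun z hz => ?_)
      have h3 := Real.rpow_nonneg (one_sub_sq_pos hz).le α
      rw [norm_mul, norm_mul, norm_pow, RCLike.norm_conj, Complex.norm_real,
        Real.norm_of_nonneg h3]
      refine mul_le_mul_of_nonneg_right ?_ h3
      exact (mul_le_of_le_one_left (norm_nonneg _)
        (pow_le_one₀ (norm_nonneg _) (mem_disc.1 hz).le)).trans (hM z hz)
  set x := 1 / Real.sqrt (monomialConst α 0) with hx
  set y := ε / Real.sqrt (monomialConst α 2) with hy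
  have hsplit : ∀ z : ℂ, ((starRingEnd ℂ) (testFun α ε z) * kernelFun α ω z) *
        (((1 - ‖z‖ ^ 2) ^ α : ℝ) : ℂ) =
      (x : ℂ) * (((starRingEnd ℂ) z ^ 0 * kernelFun α ω z) * (((1 - ‖z‖ ^ 2) ^ α : ℝ) : ℂ)) +
      (y : ℂ) * (((starRingEnd ℂ) z ^ 2 * kernelFun α ω z) *
        (((1 - ‖z‖ ^ 2) ^ α : ℝ) : ℂ)) := by
    intro z
    simp only [testFun, map_add, map_mul, map_pow, Complex.conj_ofReal, ← hx, ← hy]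
    ring
  simp_rw [hsplit]
  rw [integral_add ((hi 0).const_mul _) ((hi 2).const_mul _), integral_const_mul,
    integral_const_mul, h0, h2, iteratedDeriv_two_kernelFun hω, iteratedDeriv_zero, hk0]
  have p0 := monomialConst_zero_pos hα
  have p2 := monomialConst_two_pos hα
  have a1 : 0 < α + 1 := by linarith
  have a2 : 0 < α + 2 := by linarith
  have a3 : 0 < α + 3 := by linarith
  have hpi := Real.pi_pos
  have e0 : x * monomialConst α 0 * Real.sqrt ((α + 1) / Real.pi) = 1 := by
    have : (α + 1) / Real.pi = (monomialConst α 0)⁻¹ := by rw [monomialConst_zero hα, inv_div]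
    rw [hx, this, Real.sqrt_inv]
    have := Real.mul_self_sqrt p0.le
    have := (Real.sqrt_pos.2 p0).ne'
    field_simp
    nlinarith
  have e2 : y * monomialConst α 2 * Real.sqrt ((α + 1) / Real.pi) * ((α + 2) * (α + 3) / 2) =
      ε * Real.sqrt ((α + 2) * (α + 3) / 2) := by
    have hb : 0 ≤ (α + 2) * (α + 3) / 2 := by positivity
    have h4 : (α + 1) / Real.pi = (monomialConst α 2)⁻¹ * ((α + 2) * (α + 3) / 2)⁻¹ := by
      rw [monomialConst_two hα]; field_simp
    rw [hy, h4, Real.sqrt_mul (by positivity), Real.sqrt_inv, Real.sqrt_inv]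
    have h5 := Real.sq_sqrt p2.le
    have h6 := Real.sq_sqrt hb
    have h7 := (Real.sqrt_pos.2 p2).ne'
    have h8 := (Real.sqrt_pos.2 (by positivity : 0 < (α + 2) * (α + 3) / 2)).ne'
    set A := Real.sqrt (monomialConst α 2)
    set B := Real.sqrt ((α + 2) * (α + 3) / 2)
    rw [← h5, ← h6]
    field_simp
  have e0' := congrArg (fun t : ℝ => (t : ℂ)) e0
  have e2' := congrArg (fun t : ℝ => (t : ℂ)) e2
  simp only [Nat.factorial]
  push_cast at e0' e2' ⊢
  linear_combination (((1 - ‖ω‖ ^ 2) ^ ((α + 2) / 2) : ℝ) : ℂ) * e0' +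
    (((1 - ‖ω‖ ^ 2) ^ ((α + 2) / 2) : ℝ) : ℂ) * (starRingEnd ℂ) ω ^ 2 * e2'

/-- Expansion of the square, with unit kernels: the distance depends on ω only through the pairing.
-/
lemma bergmanNorm_sub_kernelFun_sq {α : ℝ} (hα : -1 < α) (ε : ℝ) {ω : ℂ} (hω : ω ∈ disc) (c : ℂ) :
    bergmanNorm α (fun z => testFun α ε z - c * kernelFun α ω z) ^ 2 =
      1 + ε ^ 2 + ‖c‖ ^ 2 - 2 * (c * ((((1 - ‖ω‖ ^ 2) ^ ((α + 2) / 2) : ℝ) : ℂ) *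
        (1 + (ε * Real.sqrt ((α + 2) * (α + 3) / 2) : ℝ) * (starRingEnd ℂ) ω ^ 2))).re := by
  have hk := kernel_disc hα hω
  have hf := integrableOn_testFun hα ε
  have hmeasf : Measurable (testFun α ε) := by unfold testFun; fun_prop
  have hmeask : Measurable (kernelFun α ω) := by unfold kernelFun; fun_prop
  have hcross : IntegrableOn (fun z => ((starRingEnd ℂ) (testFun α ε z) * kernelFun α ω z) *
        (((1 - ‖z‖ ^ 2) ^ α : ℝ) : ℂ)) disc := by
    refine Integrable.mono' (Integrable.add hf hk.1) ?_ ?_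
    · exact Measurable.aestronglyMeasurable (by fun_prop)
    · refine (ae_restrict_iff' measurableSet_disc).2 (ae_of_all _ fun z hz => ?_)
      have h3 := Real.rpow_nonneg (one_sub_sq_pos hz).le α
      rw [norm_mul, norm_mul, RCLike.norm_conj, Complex.norm_real, Real.norm_of_nonneg h3,
        Pi.add_apply, ← add_mul]
      refine mul_le_mul_of_nonneg_right ?_ h3
      nlinarith [sq_nonneg (‖testFun α ε z‖ - ‖kernelFun α ω z‖), sq_nonneg ‖testFun α ε z‖,
        sq_nonneg ‖kernelFun α ω z‖]
  have hpt : ∀ z : ℂ, ‖testFun α ε z - c * kernelFun α ω z‖ ^ 2 * (1 - ‖z‖ ^ 2) ^ α =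
      ‖testFun α ε z‖ ^ 2 * (1 - ‖z‖ ^ 2) ^ α +
        ‖c‖ ^ 2 * (‖kernelFun α ω z‖ ^ 2 * (1 - ‖z‖ ^ 2) ^ α) -
        2 * Complex.reCLM (c * (((starRingEnd ℂ) (testFun α ε z) * kernelFun α ω z) *
        (((1 - ‖z‖ ^ 2) ^ α : ℝ) : ℂ))) := by
    intro z
    generalize testFun α ε z = a
    generalize kernelFun α ω z = b
    generalize (1 - ‖z‖ ^ 2) ^ α = w
    simp only [← Complex.normSq_eq_norm_sq, Complex.normSq_apply, Complex.sub_re, Complex.sub_im,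
      Complex.mul_re, Complex.mul_im, Complex.conj_re, Complex.conj_im, Complex.reCLM_apply,
      Complex.ofReal_re, Complex.ofReal_im]
    ring
  have hre : Integrable (fun z => Complex.reCLM (c *
      (((starRingEnd ℂ) (testFun α ε z) * kernelFun α ω z) *
        (((1 - ‖z‖ ^ 2) ^ α : ℝ) : ℂ)))) (volume.restrict disc) :=
    Complex.reCLM.integrable_comp (hcross.const_mul c)
  have hsum : Integrable (fun z => ‖testFun α ε z‖ ^ 2 * (1 - ‖z‖ ^ 2) ^ α +
        ‖c‖ ^ 2 * (‖kernelFun α ω z‖ ^ 2 * (1 - ‖z‖ ^ 2) ^ α)) (volume.restrict disc) :=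
    Integrable.add hf (hk.1.const_mul _)
  rw [bergmanNorm_sq]
  simp_rw [hpt]
  rw [integral_sub hsum (hre.const_mul 2),
    integral_add hf (hk.1.const_mul _), integral_const_mul, integral_const_mul, hk.2,
    ← bergmanNorm_sq, bergmanNorm_testFun_sq hα,
    Complex.reCLM.integral_comp_comm (hcross.const_mul c), integral_const_mul,
    integral_conj_testFun_mul_kernelFun hα ε hω]
  simp

/-- With t = |ω|², the first factor is at most exp(-t(α+2)/2) and the second at most exp(εγt). Since
α > -1 gives γ ≤ α + 2, the condition ε ≤ 1/2 makes the total exponent nonpositive. -/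
lemma norm_pairing_le_one {α : ℝ} (hα : -1 < α) {ε : ℝ} (hε0 : 0 ≤ ε) (hε1 : ε ≤ 1 / 2) {ω : ℂ}
    (hω : ω ∈ disc) :
    ‖(((1 - ‖ω‖ ^ 2) ^ ((α + 2) / 2) : ℝ) : ℂ) *
        (1 + (ε * Real.sqrt ((α + 2) * (α + 3) / 2) : ℝ) * (starRingEnd ℂ) ω ^ 2)‖ ≤ 1 := by
  set γ := Real.sqrt ((α + 2) * (α + 3) / 2)
  have h2 := one_sub_sq_pos hω
  have hγ : γ ≤ α + 2 := Real.sqrt_le_iff.2 ⟨by linarith, by nlinarith⟩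
  have hγ0 : 0 ≤ γ := Real.sqrt_nonneg _
  have hεγ : ε * γ ≤ (α + 2) / 2 := by nlinarith
  set t := ‖ω‖ ^ 2
  have ht : 0 ≤ t := sq_nonneg _
  have hb1 : (1 - t) ^ ((α + 2) / 2) ≤ Real.exp (-(t * ((α + 2) / 2))) := by
    calc (1 - t) ^ ((α + 2) / 2) ≤ (Real.exp (-t)) ^ ((α + 2) / 2) :=
          Real.rpow_le_rpow h2.le (Real.one_sub_le_exp_neg t) (by linarith)
      _ = _ := by rw [← Real.exp_mul]; ring_nf
  have hb2 : ‖1 + ((ε * γ : ℝ) : ℂ) * (starRingEnd ℂ) ω ^ 2‖ ≤ Real.exp (ε * γ * t) := by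
    calc _ ≤ ‖(1 : ℂ)‖ + ‖((ε * γ : ℝ) : ℂ) * (starRingEnd ℂ) ω ^ 2‖ := norm_add_le _ _
      _ = ε * γ * t + 1 := by
        rw [norm_one, norm_mul, norm_pow, RCLike.norm_conj, Complex.norm_real,
          Real.norm_of_nonneg (mul_nonneg hε0 hγ0), add_comm]
      _ ≤ _ := Real.add_one_le_exp _
  rw [norm_mul, Complex.norm_real, Real.norm_of_nonneg (Real.rpow_nonneg h2.le _)]
  calc _ ≤ Real.exp (-(t * ((α + 2) / 2))) * Real.exp (ε * γ * t) :=
        mul_le_mul hb1 hb2 (norm_nonneg _) (Real.exp_nonneg _)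
    _ = Real.exp ((ε * γ - (α + 2) / 2) * t) := by rw [← Real.exp_add]; ring_nf
    _ ≤ 1 := Real.exp_le_one_iff.2 (mul_nonpos_of_nonpos_of_nonneg (by linarith) ht)

lemma extremalDist_testFun {α : ℝ} (hα : -1 < α) {ε : ℝ} (hε0 : 0 ≤ ε) (hε1 : ε ≤ 1 / 2) :
    extremalDist α (testFun α ε) = Real.sqrt (2 - 2 / Real.sqrt (1 + ε ^ 2)) := by
  have hN0 : 0 < Real.sqrt (1 + ε ^ 2) := by positivity
  have hN2 : Real.sqrt (1 + ε ^ 2) ^ 2 = 1 + ε ^ 2 := Real.sq_sqrt (by positivity)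
  have hdist : ∀ c ω : ℂ, Real.sqrt (1 + ε ^ 2) ^ 2 * (2 - 2 / Real.sqrt (1 + ε ^ 2)) ≤
      bergmanNorm α (fun z => testFun α ε z - c * kernelFun α ω z) ^ 2 →
      Real.sqrt (2 - 2 / Real.sqrt (1 + ε ^ 2)) ≤
      bergmanNorm α (fun z => testFun α ε z - c * kernelFun α ω z) / Real.sqrt (1 + ε ^ 2) := by
    intro c ω h
    refine Real.sqrt_le_iff.2 ⟨div_nonneg (Real.sqrt_nonneg _) hN0.le, ?_⟩
    rw [div_pow, le_div_iff₀ (by positivity)]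
    linarith
  have hval : Real.sqrt (1 + ε ^ 2) ^ 2 * (2 - 2 / Real.sqrt (1 + ε ^ 2)) =
      2 * (1 + ε ^ 2) - 2 * Real.sqrt (1 + ε ^ 2) := by
    rw [mul_sub, mul_div_left_comm, sq, mul_div_assoc, div_self hN0.ne']
    nlinarith
  rw [hval] at hdist
  -- The infimum is attained at ω = 0 with c equal to the norm; the bound on the pairing shows that
  -- no other choice does better.
  rw [extremalDist, bergmanNorm_testFun hα]
  refine le_antisymm (csInf_le ⟨0, ?_⟩ ⟨(Real.sqrt (1 + ε ^ 2) : ℝ), 0, ?_, zero_mem_disc, ?_⟩)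
    (le_csInf ⟨_, ⟨(Real.sqrt (1 + ε ^ 2) : ℝ), 0, ?_, zero_mem_disc, rfl⟩⟩ ?_)
  · rintro d ⟨c, ω, -, -, rfl⟩
    exact div_nonneg (Real.sqrt_nonneg _) hN0.le
  · rw [Complex.norm_real, Real.norm_of_nonneg hN0.le]
  · have h := bergmanNorm_sub_kernelFun_sq hα ε zero_mem_disc ((Real.sqrt (1 + ε ^ 2) : ℝ) : ℂ)
    simp only [norm_zero, map_zero, ne_eq, OfNat.ofNat_ne_zero, not_false_eq_true, zero_pow,
      sub_zero, Real.one_rpow, Complex.ofReal_one, mul_zero, add_zero, mul_one,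
      Complex.norm_real, Complex.ofReal_re, Real.norm_of_nonneg hN0.le, hN2] at h
    have hb : 0 ≤ bergmanNorm α (fun z => testFun α ε z -
        ((Real.sqrt (1 + ε ^ 2) : ℝ) : ℂ) * kernelFun α 0 z) := Real.sqrt_nonneg _
    rw [eq_div_iff hN0.ne', ← Real.sqrt_sq hb, h]
    nth_rewrite 2 [← Real.sqrt_sq hN0.le]
    rw [← Real.sqrt_mul' _ (sq_nonneg _), mul_comm, hval]
    congr 1
    ring
  · rw [Complex.norm_real, Real.norm_of_nonneg hN0.le]
  · rintro d ⟨c, ω, hc, hω, rfl⟩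
    refine hdist c ω ?_
    rw [bergmanNorm_sub_kernelFun_sq hα ε hω, hc, hN2]
    have h1 := norm_pairing_le_one hα hε0 hε1 hω
    set P := (((1 - ‖ω‖ ^ 2) ^ ((α + 2) / 2) : ℝ) : ℂ) *
        (1 + (ε * Real.sqrt ((α + 2) * (α + 3) / 2) : ℝ) * (starRingEnd ℂ) ω ^ 2)
    have h2 : (c * P).re ≤ Real.sqrt (1 + ε ^ 2) := by
      calc (c * P).re ≤ ‖c * P‖ := Complex.re_le_norm _
        _ = Real.sqrt (1 + ε ^ 2) * ‖P‖ := by rw [norm_mul, hc]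
        _ ≤ _ := mul_le_of_le_one_right hN0.le h1
    linarith

lemma extremalDist_testFun_sq {α : ℝ} (hα : -1 < α) {ε : ℝ} (hε0 : 0 ≤ ε) (hε1 : ε ≤ 1 / 2) :
    extremalDist α (testFun α ε) ^ 2 =
      2 * ε ^ 2 / (Real.sqrt (1 + ε ^ 2) * (Real.sqrt (1 + ε ^ 2) + 1)) := by
  have hN1 : 1 ≤ Real.sqrt (1 + ε ^ 2) := Real.one_le_sqrt.2 (by nlinarith [sq_nonneg ε])
  have hN2 : Real.sqrt (1 + ε ^ 2) ^ 2 = 1 + ε ^ 2 := Real.sq_sqrt (by positivity)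
  have h0 : 0 ≤ 2 - 2 / Real.sqrt (1 + ε ^ 2) := by
    rw [sub_nonneg, div_le_iff₀ (by linarith)]; linarith
  rw [extremalDist_testFun hα hε0 hε1, Real.sq_sqrt h0, show ε ^ 2 = Real.sqrt (1 + ε ^ 2) ^ 2 - 1
    by linarith]
  rw [show 1 + (Real.sqrt (1 + ε ^ 2) ^ 2 - 1) = 1 + ε ^ 2 by linarith]
  have : Real.sqrt (1 + ε ^ 2) ≠ 0 := by linarith
  have : Real.sqrt (1 + ε ^ 2) + 1 ≠ 0 := by linarith
  field_simp
  ring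

lemma extremalDist_nonneg (α : ℝ) (f : ℂ → ℂ) : 0 ≤ extremalDist α f := by
  refine Real.sInf_nonneg ?_
  rintro d ⟨c, ω, -, -, rfl⟩
  exact div_nonneg (Real.sqrt_nonneg _) (Real.sqrt_nonneg _)

lemma extremalDist_testFun_pos {α : ℝ} (hα : -1 < α) {ε : ℝ} (hε0 : 0 < ε) (hε1 : ε ≤ 1 / 2) :
    0 < extremalDist α (testFun α ε) := by
  have h := extremalDist_testFun_sq hα hε0.le hε1
  refine lt_of_le_of_ne (extremalDist_nonneg _ _) fun h0 => ?_
  rw [← h0] at h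
  have : 0 < 2 * ε ^ 2 / (Real.sqrt (1 + ε ^ 2) * (Real.sqrt (1 + ε ^ 2) + 1)) := by positivity
  simp [← h] at this

/-! ### Deficits on centred discs. -/

lemma setIntegral_hypMeasure (α : ℝ) (f : ℂ → ℂ) {Ω : Set ℂ} (hΩ : MeasurableSet Ω)
    (hd : Ω ⊆ disc) :
    ∫ z in Ω, ‖f z‖ ^ 2 * (1 - ‖z‖ ^ 2) ^ (α + 2) ∂hypMeasure =
      ∫ z in Ω, ‖f z‖ ^ 2 * (1 - ‖z‖ ^ 2) ^ α := by
  rw [hypMeasure, setIntegral_withDensity_eq_setIntegral_toReal_smul measurable_hypDensity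
    (ae_of_all _ fun _ => ENNReal.ofReal_lt_top) _ hΩ, Measure.restrict_restrict hΩ,
    inter_eq_self_of_subset_left hd]
  refine setIntegral_congr_fun hΩ fun z hz => ?_
  have h := one_sub_sq_pos (hd hz)
  simp only [smul_eq_mul]
  rw [ENNReal.toReal_ofReal (by positivity), Real.rpow_add h, Real.rpow_two]
  field_simp

lemma deficit_eq {α s : ℝ} (hs : 0 < s) (f : ℂ → ℂ) {Ω : Set ℂ} (hΩ : MeasurableSet Ω)
    (hd : Ω ⊆ disc) (hμ : hypMeasure Ω = ENNReal.ofReal s) :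
    deficit α f Ω = (bergmanNorm α f ^ 2 * theta α s -
      ∫ z in Ω, ‖f z‖ ^ 2 * (1 - ‖z‖ ^ 2) ^ α) / (bergmanNorm α f ^ 2 * theta α s) := by
  have : hypMeasure.real Ω = s := by rw [Measure.real, hμ, ENNReal.toReal_ofReal hs.le]
  rw [deficit, this, setIntegral_hypMeasure α f hΩ hd]

lemma theta_eq {α s : ℝ} (hs : 0 < s) :
    theta α s = 1 - ((1 + s / Real.pi)⁻¹) ^ (α + 1) := by
  have : 0 < 1 + s / Real.pi := by have := Real.pi_pos; positivity
  rw [theta, show -α - 1 = -(α + 1) by ring, Real.rpow_neg this.le, Real.inv_rpow this.le]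

lemma theta_pos {α s : ℝ} (hα : -1 < α) (hs : 0 < s) : 0 < theta α s := by
  have : 0 < s / Real.pi := div_pos hs Real.pi_pos
  rw [theta, sub_pos]
  exact Real.rpow_lt_one_of_one_lt_of_neg (by linarith) (by linarith)

lemma centredDisc_subset_disc {s : ℝ} (hs : 0 < s) : centredDisc s ⊆ disc := by
  refine Metric.ball_subset_ball (Real.sqrt_le_one.2 ?_)
  have := Real.pi_pos
  rw [div_le_one (by linarith)]
  linarith

lemma measurableSet_centredDisc (s : ℝ) : MeasurableSet (centredDisc s) :=
  Metric.isOpen_ball.measurableSet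

lemma inv_one_add_mem {s : ℝ} (hs : 0 < s) :
    0 < (1 + s / Real.pi)⁻¹ ∧ (1 + s / Real.pi)⁻¹ < 1 := by
  have : 0 < s / Real.pi := div_pos hs Real.pi_pos
  exact ⟨by positivity, inv_lt_one_of_one_lt₀ (by linarith)⟩

/-- Mass of the test function over a centred disc. -/
lemma integral_testFun_centredDisc {α : ℝ} (hα : -1 < α) (ε : ℝ) {s : ℝ} (hs : 0 < s) {u : ℝ}
    (hu : u = (1 + s / Real.pi)⁻¹) :
    ∫ z in centredDisc s, ‖testFun α ε z‖ ^ 2 * (1 - ‖z‖ ^ 2) ^ α =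
      1 + ε ^ 2 - u ^ (α + 1) * (1 + ε ^ 2 * ((α + 2) * (α + 3) / 2 - (α + 1) * (α + 3) * u +
        (α + 1) * (α + 2) / 2 * u ^ 2)) := by
  obtain ⟨hu0, hu1⟩ := inv_one_add_mem hs
  rw [← hu] at hu0 hu1
  have h := lintegral_quadratic_ball hα (1 / Real.sqrt (monomialConst α 0))
    (ε / Real.sqrt (monomialConst α 2)) hu0.le hu1.le
  rw [hu, ← centredDisc_eq hs, ← hu] at h
  have hle := radialPrim_le_one hα (A := (1 / Real.sqrt (monomialConst α 0)) ^ 2) (B := 0)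
    (C := (ε / Real.sqrt (monomialConst α 2)) ^ 2) (fun r => by positivity) hu0.le hu1.le
  have hI := (integrableOn_and_integral_eq_of_lintegral (measurableSet_centredDisc s)
    (by unfold testFun; fun_prop)
    (fun z hz => weighted_nonneg α (testFun α ε) (centredDisc_subset_disc hs hz))
    (mul_nonneg Real.pi_pos.le (sub_nonneg.2 hle)) h).2
  unfold testFun at hI ⊢
  rw [hI, radialPrim_one hα,
    (testFun_sq_coeffs hα ε).1, (testFun_sq_coeffs hα ε).2]
  have a1 : α + 1 ≠ 0 := by linarith
  have a2 : α + 2 ≠ 0 := by linarith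
  have a3 : α + 3 ≠ 0 := by linarith
  have hpi := Real.pi_pos
  unfold radialPrim
  rw [show α + 2 = α + 1 + 1 by ring, show α + 3 = α + 1 + 2 by ring] at *
  rw [Real.rpow_add hu0 (α + 1) 1, Real.rpow_add hu0 (α + 1) 2, Real.rpow_one, Real.rpow_two]
  field_simp
  ring

/-- There is no term linear in ε, because the cross term averages out. The formula is exact and
serves three regimes: ε → 0 with s fixed, s → 0 (u → 1), and α → -1. -/
lemma deficit_testFun_centredDisc {α : ℝ} (hα : -1 < α) (ε : ℝ) {s : ℝ} (hs : 0 < s) {u : ℝ}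
    (hu : u = (1 + s / Real.pi)⁻¹) :
    deficit α (testFun α ε) (centredDisc s) =
      ε ^ 2 / (1 + ε ^ 2) * (u ^ (α + 1) * ((α + 1) / 2 * (1 - u) * (α + 4 - (α + 2) * u)) /
        (1 - u ^ (α + 1))) := by
  have ht := theta_pos hα hs
  rw [deficit_eq hs _ (measurableSet_centredDisc s) (centredDisc_subset_disc hs)
    (hypMeasure_centredDisc hs), bergmanNorm_testFun_sq hα, integral_testFun_centredDisc hα ε hs hu]
  rw [theta_eq hs, ← hu] at *
  have : 1 + ε ^ 2 ≠ 0 := by positivity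
  field_simp
  ring

/-! ### Optimal exponent in the function estimate. -/

/-- A linear lower bound is incompatible with an upper bound of order `ε ^ (2 * β)`, `β > 1/2`. -/
lemma not_forall_mul_le_rpow {a L M β ε₀ : ℝ} (ha : 0 < a) (hM : 0 ≤ M) (hβ : 1 / 2 < β)
    (h0 : 0 < ε₀) : ¬ ∀ ε, 0 < ε → ε ≤ ε₀ → a * ε ≤ L * (M * ε ^ 2) ^ β := by
  intro h
  -- Dividing the supposed inequality by ε leaves a ≤ L M^β ε^(2β-1), whose right side vanishes in
  -- the limit.
  have hlim : Tendsto (fun ε : ℝ => L * M ^ β * ε ^ (2 * β - 1)) (𝓝[>] 0) (𝓝 0) := by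
    have h1 : Tendsto (fun ε : ℝ => ε ^ (2 * β - 1)) (𝓝[>] 0) (𝓝 0) := by
      have := (Real.continuous_rpow_const (q := 2 * β - 1) (by linarith)).tendsto 0
      rw [Real.zero_rpow (by linarith)] at this
      exact this.mono_left nhdsWithin_le_nhds
    simpa using h1.const_mul (L * M ^ β)
  have hle : a ≤ 0 := by
    refine ge_of_tendsto hlim ?_
    filter_upwards [Ioc_mem_nhdsGT h0] with ε hε
    have h2 := h ε hε.1 hε.2
    rw [Real.mul_rpow hM (sq_nonneg _), ← Real.rpow_natCast_mul hε.1.le] at h2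
    have h3 : ε ^ (((2 : ℕ) : ℝ) * β) = ε ^ (2 * β - 1) * ε := by
      rw [← Real.rpow_add_one hε.1.ne']
      congr 1
      push_cast
      ring
    rw [h3] at h2
    refine le_of_mul_le_mul_right ?_ hε.1
    linarith
  linarith

/-- Absolute values avoid any discussion of the signs of the constant and of the deficit. -/
lemma mul_rpow_le_abs {K δ t β : ℝ} (h : |δ| ≤ t) (hβ : 0 ≤ β) : K * δ ^ β ≤ |K| * t ^ β := by
  calc K * δ ^ β ≤ |K * δ ^ β| := le_abs_self _
    _ = |K| * |δ ^ β| := abs_mul _ _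
    _ ≤ |K| * |δ| ^ β := mul_le_mul_of_nonneg_left (Real.abs_rpow_le_abs_rpow _ _) (abs_nonneg _)
    _ ≤ _ := mul_le_mul_of_nonneg_left (Real.rpow_le_rpow (abs_nonneg _) h hβ) (abs_nonneg _)

lemma half_le_extremalDist_testFun {α : ℝ} (hα : -1 < α) {ε : ℝ} (hε0 : 0 < ε)
    (hε1 : ε ≤ 1 / 2) : 1 / 2 * ε ≤ extremalDist α (testFun α ε) := by
  refine le_of_sq_le_sq ?_ (extremalDist_nonneg _ _)
  rw [extremalDist_testFun_sq hα hε0.le hε1]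
  have hN : Real.sqrt (1 + ε ^ 2) ≤ 2 := Real.sqrt_le_iff.2 ⟨by norm_num, by nlinarith⟩
  rw [le_div_iff₀ (by positivity)]
  have h6 : Real.sqrt (1 + ε ^ 2) * (Real.sqrt (1 + ε ^ 2) + 1) ≤ 6 := by
    nlinarith [Real.sqrt_nonneg (1 + ε ^ 2)]
  nlinarith [sq_nonneg ε]

/-- The exponent `1/2` in the function estimate cannot be improved. -/
lemma not_functionEstimate {α β s : ℝ} (hα : -1 < α) (hβ : 1 / 2 < β) (hs : 0 < s) :
    ¬ ∃ K : ℝ, FunctionEstimate α s K β := by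
  rintro ⟨K, hK⟩
  obtain ⟨hu0, hu1⟩ := inv_one_add_mem hs
  set u := (1 + s / Real.pi)⁻¹ with hu
  set G := u ^ (α + 1) * ((α + 1) / 2 * (1 - u) * (α + 4 - (α + 2) * u)) / (1 - u ^ (α + 1))
  refine not_forall_mul_le_rpow (a := 1 / 2) (L := |K|) (M := |G|) (by norm_num) (abs_nonneg _) hβ
    (by norm_num : (0 : ℝ) < 1 / 2) fun ε hε0 hε1 => ?_
  refine (half_le_extremalDist_testFun hα hε0 hε1).trans ((hK _ (measurableSet_centredDisc s)
    (centredDisc_subset_disc hs) (hypMeasure_centredDisc hs) _ (memBergman_testFun hα ε)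
    (bergmanNorm_testFun_pos hα ε)).trans (mul_rpow_le_abs ?_ (by linarith)))
  rw [deficit_testFun_centredDisc hα ε hs hu, abs_mul, mul_comm,
    abs_of_nonneg (by positivity : 0 ≤ ε ^ 2 / (1 + ε ^ 2))]
  refine mul_le_mul_of_nonneg_left (div_le_self (sq_nonneg _) ?_) (abs_nonneg _)
  nlinarith [sq_nonneg ε]

/-! ### Second differences of `theta`. -/

/-- Second order expansion of `(1 + x) ^ (-p)` at `0`. -/
lemma abs_one_add_rpow_sub_le (p : ℝ) {κ : ℝ} (hκ : 0 < κ) :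
    ∃ d > 0, d < 1 ∧ ∀ x : ℝ, |x| ≤ d →
      |(1 + x) ^ (-p) - (1 - p * x + p * (p + 1) / 2 * x ^ 2)| ≤ κ * x ^ 2 := by
  have hderiv : ∀ q x : ℝ, |x| < 1 →
      HasDerivAt (fun x : ℝ => (1 + x) ^ (-q)) (-q * (1 + x) ^ (-(q + 1))) x := by
    intro q x hx
    have h1 : HasDerivAt (fun x : ℝ => 1 + x) 1 x := (hasDerivAt_id x).const_add 1
    have h2 := h1.rpow_const (p := -q) (Or.inl (by linarith [(abs_lt.1 hx).1]))
    refine h2.congr_deriv ?_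
    rw [show -(q + 1) = -q - 1 by ring]
    ring
  -- The derivative of the remainder is -p times the first-order remainder of (1+x)^(-(p+1)), hence
  -- o(x). The mean value inequality on [-|x|, |x|] then gives the quadratic bound. The 1 in |p| + 1
  -- covers p = 0.
  have h0 := (hderiv (p + 1) 0 (by simp)).isLittleO
  have h1 := h0.def (c := κ / (|p| + 1)) (by positivity)
  simp only [add_zero, Real.one_rpow, mul_one, sub_zero, smul_eq_mul] at h1
  obtain ⟨d, hd, hball⟩ := Metric.eventually_nhds_iff.1 h1
  refine ⟨min (d / 2) (1 / 2), by positivity, by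
    exact lt_of_le_of_lt (min_le_right _ _) (by norm_num), fun x hx => ?_⟩
  have hbound : ∀ y ∈ Icc (-|x|) |x|,
      ‖-p * (1 + y) ^ (-(p + 1)) - (-p + p * (p + 1) * y)‖ ≤ κ * |x| := by
    intro y hy
    have hy' : |y| ≤ |x| := abs_le.2 hy
    have hyd : dist y 0 < d := by
      rw [Real.dist_eq, sub_zero]
      have := min_le_left (d / 2) (1 / 2)
      linarith
    have h2 := hball hyd
    rw [show -p * (1 + y) ^ (-(p + 1)) - (-p + p * (p + 1) * y) =
      -p * ((1 + y) ^ (-(p + 1)) - 1 - y * -(p + 1)) by ring, norm_mul, norm_neg]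
    calc ‖p‖ * ‖(1 + y) ^ (-(p + 1)) - 1 - y * -(p + 1)‖
        ≤ (|p| + 1) * (κ / (|p| + 1) * ‖y‖) := by
          refine mul_le_mul ?_ h2 (norm_nonneg _) (by positivity)
          rw [Real.norm_eq_abs]; linarith
      _ = κ * |y| := by rw [Real.norm_eq_abs]; field_simp
      _ ≤ κ * |x| := by gcongr
  have hder : ∀ y ∈ Icc (-|x|) |x|, HasDerivWithinAt
      (fun x : ℝ => (1 + x) ^ (-p) - (1 - p * x + p * (p + 1) / 2 * x ^ 2))
      (-p * (1 + y) ^ (-(p + 1)) - (-p + p * (p + 1) * y)) (Icc (-|x|) |x|) y := by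
    intro y hy
    have hy' : |y| ≤ |x| := abs_le.2 hy
    have h2 : HasDerivAt (fun x : ℝ => 1 - p * x + p * (p + 1) / 2 * x ^ 2)
        (-p + p * (p + 1) * y) y := by
      have h3 := (((hasDerivAt_id y).const_mul p).const_sub 1).add
        ((hasDerivAt_pow 2 y).const_mul (p * (p + 1) / 2))
      refine h3.congr_deriv ?_
      norm_num
      ring
    refine ((hderiv p y ?_).sub h2).hasDerivWithinAt
    have := min_le_right (d / 2) (1 / 2)
    linarith
  have := (convex_Icc (-|x|) |x|).norm_image_sub_le_of_norm_hasDerivWithin_le hder hbound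
    (x := 0) (y := x) ⟨by simp, by simp⟩ ⟨neg_abs_le x, le_abs_self x⟩
  simp only [add_zero, Real.one_rpow, mul_zero, sub_zero, sub_self, Real.norm_eq_abs, ne_eq,
    OfNat.ofNat_ne_zero, not_false_eq_true, zero_pow] at this
  rw [mul_assoc, abs_mul_abs_self, ← sq] at this
  exact this

/-- The terms linear in η cancel between s - η and s + η. -/
lemma abs_theta_second_diff_le {α s : ℝ} (hs : 0 < s) :
    ∃ M ≥ 0, ∃ η₀ > 0, η₀ < s ∧ ∀ η, 0 < η → η ≤ η₀ →
      |2 * theta α s - theta α (s - η) - theta α (s + η)| ≤ M * η ^ 2 := by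
  have hpi := Real.pi_pos
  obtain ⟨d, hd0, hd1, hd⟩ := abs_one_add_rpow_sub_le (α + 1) one_pos
  set σ := 1 + s / Real.pi with hσ
  have hσ0 : 1 < σ := by
    have : 0 < s / Real.pi := by positivity
    linarith
  -- Chosen so that 1 + (s + η)/π = σ(1 + kη).
  set k := (Real.pi * σ)⁻¹
  have hk : 0 < k := by positivity
  have hcoef : 0 ≤ |(α + 1) * (α + 1 + 1) / 2| + 1 := by positivity
  refine ⟨σ ^ (-(α + 1)) * (2 * (|(α + 1) * (α + 1 + 1) / 2| + 1) * k ^ 2), by positivity,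
    min (d / k) (s / 2), by positivity, lt_of_le_of_lt (min_le_right _ _) (by linarith),
    fun η hη0 hη1 => ?_⟩
  have hth : ∀ x : ℝ, |x| ≤ d →
      theta α (s + x / k) = 1 - σ ^ (-(α + 1)) * (1 + x) ^ (-(α + 1)) := by
    intro x hx
    have hx1 : 0 ≤ 1 + x := by linarith [(abs_le.1 hx).1]
    rw [theta, ← Real.mul_rpow (by linarith) hx1, show -α - 1 = -(α + 1) by ring]
    congr 2
    simp only [k, hσ]
    field_simp
    ring
  have hkη : |k * η| ≤ d := by
    rw [abs_of_pos (by positivity)]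
    have := hη1.trans (min_le_left _ _)
    rwa [le_div_iff₀ hk, mul_comm] at this
  have e1 := hth (k * η) hkη
  have e2 := hth (-(k * η)) (by rwa [abs_neg])
  have e0 := hth 0 (by simpa using hd0.le)
  rw [mul_div_cancel_left₀ _ hk.ne'] at e1
  rw [neg_div, mul_div_cancel_left₀ _ hk.ne', ← sub_eq_add_neg] at e2
  simp only [zero_div, add_zero, Real.one_rpow, mul_one] at e0
  have b1 := hd (k * η) hkη
  have b2 := hd (-(k * η)) (by rwa [abs_neg])
  rw [e0, e1, e2]
  set P := (1 + k * η) ^ (-(α + 1))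
  set Q := (1 + -(k * η)) ^ (-(α + 1))
  set c := (α + 1) * (α + 1 + 1) / 2
  rw [show 2 * (1 - σ ^ (-(α + 1))) - (1 - σ ^ (-(α + 1)) * Q) - (1 - σ ^ (-(α + 1)) * P) =
    σ ^ (-(α + 1)) * (P + Q - 2) by ring, abs_mul, abs_of_nonneg (by positivity), mul_assoc]
  refine mul_le_mul_of_nonneg_left ?_ (by positivity)
  have hc1 := le_abs_self c
  have hc2 := neg_abs_le c
  have hq : 0 ≤ (k * η) ^ 2 := sq_nonneg _
  rw [abs_le] at b1 b2 ⊢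
  constructor <;> nlinarith

/-! ### Asymmetry and deficit of ringed discs; optimal exponent in the set estimate. -/

lemma hypMeasure_neg {S : Set ℂ} (hS : MeasurableSet S) :
    hypMeasure ((fun z => -z) ⁻¹' S) = hypMeasure S := by
  have h := lintegral_comp_moebius (F := S.indicator 1) (measurable_one.indicator hS) zero_mem_disc
  have h2 : ∀ z, S.indicator (1 : ℂ → ENNReal) (moebius 0 z) =
      ((fun z => -z) ⁻¹' S).indicator 1 z := fun z => by
    rw [show moebius 0 z = -z by simp [moebius]]
    rfl
  simp_rw [h2] at h
  rwa [lintegral_indicator_one (measurable_neg hS), lintegral_indicator_one hS] at h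

/-- In the half-plane facing away from x, the pseudohyperbolic distance from z to x is at least that
from z to 0. This follows from |z-x|² - |z|²|1-x̄z|² = (1-|z|²)(|x|²(1+|z|²) - 2 Re(x̄z)). -/
lemma norm_mul_norm_le_of_re_nonpos {x z : ℂ} (hz : z ∈ disc)
    (h : ((starRingEnd ℂ) x * z).re ≤ 0) :
    ‖z‖ * ‖1 - (starRingEnd ℂ) x * z‖ ≤ ‖z - x‖ := by
  refine le_of_sq_le_sq ?_ (norm_nonneg _)
  have h1 := one_sub_sq_pos hz
  rw [mul_pow]
  simp only [← Complex.normSq_eq_norm_sq, Complex.normSq_apply, Complex.sub_re, Complex.sub_im,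
    Complex.mul_re, Complex.mul_im, Complex.conj_re, Complex.conj_im, Complex.one_re,
    Complex.one_im] at h h1 ⊢
  set R := x.re * z.re - -x.im * z.im
  set t := z.re * z.re + z.im * z.im
  set X := x.re * x.re + x.im * x.im
  have ht : 0 ≤ t := add_nonneg (mul_self_nonneg _) (mul_self_nonneg _)
  have hX : 0 ≤ X := add_nonneg (mul_self_nonneg _) (mul_self_nonneg _)
  have key : (z.re - x.re) * (z.re - x.re) + (z.im - x.im) * (z.im - x.im) -
      t * ((1 - R) * (1 - R) + (0 - (x.re * z.im + -x.im * z.re)) *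
        (0 - (x.re * z.im + -x.im * z.re))) = (1 - t) * (X * (1 + t) - 2 * R) := by
    simp only [R, t, X]; ring
  have : 0 ≤ (1 - t) * (X * (1 + t) - 2 * R) := by
    refine mul_nonneg h1.le ?_
    have : 0 ≤ X * (1 + t) := by positivity
    linarith
  linarith

lemma centredDisc_mono {s t : ℝ} (hs : 0 < s) (hst : s ≤ t) : centredDisc s ⊆ centredDisc t := by
  refine Metric.ball_subset_ball (Real.sqrt_le_sqrt ?_)
  have := Real.pi_pos
  rw [div_le_div_iff₀ (by linarith) (by linarith)]
  nlinarith

/-- A larger radius would, by continuity, leave room for a centred disc of measure t > s inside the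
ball of radius ρ, whose measure is s. -/
lemma hypDisc_radius_le {s : ℝ} (hs : 0 < s) {x : ℂ} (hx : x ∈ disc) {ρ : ℝ}
    (h : hypMeasure (hypDisc x ρ) = ENNReal.ofReal s) : ρ ≤ Real.sqrt (s / (s + Real.pi)) := by
  by_contra! hlt
  have hpi := Real.pi_pos
  have hc : ContinuousAt (fun t : ℝ => Real.sqrt (t / (t + Real.pi))) s :=
    (continuousAt_id.div (by fun_prop) (by positivity)).sqrt
  have h1 : ∀ᶠ t in 𝓝[>] s, Real.sqrt (t / (t + Real.pi)) < ρ :=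
    (hc.eventually_lt continuousAt_const hlt).filter_mono nhdsWithin_le_nhds
  obtain ⟨t, ht, hst⟩ := (h1.and self_mem_nhdsWithin).exists
  have hst' : s < t := hst
  have h2 : hypMeasure (centredDisc t) ≤ hypMeasure (Metric.ball 0 ρ) :=
    measure_mono (Metric.ball_subset_ball ht.le)
  rw [hypMeasure_centredDisc (hs.trans hst'), ← hypMeasure_hypDisc hx, h] at h2
  exact absurd ((ENNReal.ofReal_le_ofReal_iff hs.le).1 h2) (not_le.2 hst')

/-- The disc of measure `s` with a ring of measure `η` moved across its boundary. -/
def ringedDisc (s η : ℝ) : Set ℂ :=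
  centredDisc (s - η) ∪ (centredDisc (s + η) \ centredDisc s)

lemma measurableSet_ringedDisc (s η : ℝ) : MeasurableSet (ringedDisc s η) :=
  (measurableSet_centredDisc _).union
    ((measurableSet_centredDisc _).diff (measurableSet_centredDisc _))

section Ring

variable {s η : ℝ}

lemma ringedDisc_subset_disc (hη : 0 < η) (hηs : η < s) : ringedDisc s η ⊆ disc :=
  union_subset (centredDisc_subset_disc (by linarith))
    (sdiff_subset.trans (centredDisc_subset_disc (by linarith)))

lemma disjoint_ring (hη : 0 < η) (hηs : η < s) :
    Disjoint (centredDisc (s - η)) (centredDisc (s + η) \ centredDisc s) :=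
  disjoint_sdiff_right.mono_left (centredDisc_mono (by linarith) (by linarith))

lemma hypMeasure_ring (hη : 0 < η) (hηs : η < s) :
    hypMeasure (centredDisc (s + η) \ centredDisc s) = ENNReal.ofReal η := by
  have hs : 0 < s := hη.trans hηs
  rw [measure_sdiff (centredDisc_mono hs (by linarith)) (measurableSet_centredDisc s).nullMeasurableSet
    (by rw [hypMeasure_centredDisc hs]; exact ENNReal.ofReal_ne_top),
    hypMeasure_centredDisc hs, hypMeasure_centredDisc (by linarith), ← ENNReal.ofReal_sub _ hs.le]
  congr 1
  ring

lemma hypMeasure_ringedDisc (hη : 0 < η) (hηs : η < s) :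
    hypMeasure (ringedDisc s η) = ENNReal.ofReal s := by
  rw [ringedDisc, measure_union (disjoint_ring hη hηs)
    ((measurableSet_centredDisc _).diff (measurableSet_centredDisc _)), hypMeasure_ring hη hηs,
    hypMeasure_centredDisc (by linarith), ← ENNReal.ofReal_add (by linarith) hη.le]
  congr 1
  ring

/-- Points of the outer ring have modulus at least the radius belonging to s. Those in the
half-plane Re(x̄z) ≤ 0 are therefore outside any disc centred at x of measure s. By symmetry under z
↦ -z they carry at least half of the measure η of the ring. -/
lemma le_asymmetry_ringedDisc (hη : 0 < η) (hηs : η < s) :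
    (2 * s)⁻¹ * η ≤ asymmetry (ringedDisc s η) := by
  have hs : 0 < s := hη.trans hηs
  have hμ := hypMeasure_ringedDisc hη hηs
  have hreal : hypMeasure.real (ringedDisc s η) = s := by
    rw [Measure.real, hμ, ENNReal.toReal_ofReal hs.le]
  rw [asymmetry, hreal]
  -- The centred disc shows that there are competitors; the infimum of an empty set would be 0.
  refine le_csInf ⟨_, ⟨0, Real.sqrt (s / (s + Real.pi)), zero_mem_disc, ?_, rfl⟩⟩ ?_
  · rw [hypMeasure_hypDisc zero_mem_disc, hμ]
    exact hypMeasure_centredDisc hs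
  rintro d ⟨x, ρ, hx, hB, rfl⟩
  rw [hμ] at hB
  have hρ := hypDisc_radius_le hs hx hB
  set A := centredDisc (s + η) \ centredDisc s with hA
  have hAm : MeasurableSet A :=
    (measurableSet_centredDisc _).diff (measurableSet_centredDisc _)
  set H : Set ℂ := {z | ((starRingEnd ℂ) x * z).re ≤ 0} with hH
  have hHm : MeasurableSet H := measurableSet_le (by fun_prop) measurable_const
  have hsub : A ∩ H ⊆ symmDiff (ringedDisc s η) (hypDisc x ρ) := by
    rintro z ⟨hzA, hzH⟩
    refine Or.inl ⟨Or.inr hzA, fun hzB => hzA.2 ?_⟩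
    have h1 := norm_mul_norm_le_of_re_nonpos hzB.1 hzH
    have h2 := lt_of_le_of_lt h1 hzB.2
    have h3 := lt_of_mul_lt_mul_right h2 (norm_nonneg _)
    simpa [centredDisc] using lt_of_lt_of_le h3 hρ
  have hcover : A ⊆ (A ∩ H) ∪ (fun z => -z) ⁻¹' (A ∩ H) := by
    intro z hz
    rcases le_total ((starRingEnd ℂ) x * z).re 0 with h | h
    · exact Or.inl ⟨hz, h⟩
    · refine Or.inr ⟨?_, ?_⟩
      · simpa [hA, centredDisc] using hz
      · simp only [hH, mem_ofPred_eq, mul_neg, Complex.neg_re]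
        linarith
  have hmass : ENNReal.ofReal η ≤ 2 * hypMeasure (symmDiff (ringedDisc s η) (hypDisc x ρ)) := by
    calc ENNReal.ofReal η = hypMeasure A := (hypMeasure_ring hη hηs).symm
      _ ≤ hypMeasure (A ∩ H) + hypMeasure ((fun z => -z) ⁻¹' (A ∩ H)) :=
        (measure_mono hcover).trans (measure_union_le _ _)
      _ = 2 * hypMeasure (A ∩ H) := by rw [hypMeasure_neg (hAm.inter hHm), two_mul]
      _ ≤ _ := by gcongr
  have hfin : hypMeasure (symmDiff (ringedDisc s η) (hypDisc x ρ)) ≠ ⊤ := by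
    refine ne_top_of_le_ne_top ?_ ((measure_mono symmDiff_subset_union).trans
      (measure_union_le _ _))
    rw [hμ, hB]
    exact ENNReal.add_ne_top.2 ⟨ENNReal.ofReal_ne_top, ENNReal.ofReal_ne_top⟩
  have h4 := ENNReal.toReal_mono (ENNReal.mul_ne_top (by simp) hfin) hmass
  rw [ENNReal.toReal_ofReal hη.le, ENNReal.toReal_mul] at h4
  rw [le_div_iff₀ hs]
  have : (2 * s)⁻¹ * η * s = η / 2 := by field_simp
  rw [this, Measure.real]
  simp only [ENNReal.toReal_ofNat] at h4
  linarith

lemma integral_testFun_zero_centredDisc {α t : ℝ} (hα : -1 < α) (ht : 0 < t) :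
    ∫ z in centredDisc t, ‖testFun α 0 z‖ ^ 2 * (1 - ‖z‖ ^ 2) ^ α = theta α t := by
  rw [integral_testFun_centredDisc hα 0 ht rfl, theta_eq ht]
  ring

/-- For ε = 0 the function is extremal with mass `theta α t` on the centred disc of measure t, so
the ringed disc has mass θ(s-η) + θ(s+η) - θ(s). -/
lemma deficit_ringedDisc {α : ℝ} (hα : -1 < α) (hη : 0 < η) (hηs : η < s) :
    deficit α (testFun α 0) (ringedDisc s η) =
      (2 * theta α s - theta α (s - η) - theta α (s + η)) / theta α s := by
  have hs : 0 < s := hη.trans hηs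
  have hintegral : ∀ S ⊆ disc, IntegrableOn
      (fun z : ℂ => ‖testFun α 0 z‖ ^ 2 * (1 - ‖z‖ ^ 2) ^ α) S := fun S hS =>
    (integrableOn_testFun hα 0).mono_set hS
  rw [deficit_eq hs _ (measurableSet_ringedDisc s η) (ringedDisc_subset_disc hη hηs)
    (hypMeasure_ringedDisc hη hηs), bergmanNorm_testFun_sq hα, ringedDisc,
    setIntegral_union (disjoint_ring hη hηs)
      ((measurableSet_centredDisc _).diff (measurableSet_centredDisc _))
      (hintegral _ (centredDisc_subset_disc (by linarith)))
      (hintegral _ (sdiff_subset.trans (centredDisc_subset_disc (by linarith)))),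
    setIntegral_sdiff (measurableSet_centredDisc s)
      (hintegral _ (centredDisc_subset_disc (by linarith))) (centredDisc_mono hs (by linarith)),
    integral_testFun_zero_centredDisc hα hs, integral_testFun_zero_centredDisc hα (by linarith),
    integral_testFun_zero_centredDisc hα (by linarith)]
  congr 1 <;> ring

end Ring

/-- The exponent `1/2` in the set estimate cannot be improved. -/
lemma not_setEstimate {α β s : ℝ} (hα : -1 < α) (hβ : 1 / 2 < β) (hs : 0 < s) :
    ¬ ∃ K : ℝ, SetEstimate α s K β := by
  rintro ⟨K, hK⟩
  have ht := theta_pos hα hs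
  obtain ⟨M, hM, η₀, hη₀, hη₀s, hbound⟩ := abs_theta_second_diff_le (α := α) hs
  refine not_forall_mul_le_rpow (a := (2 * s)⁻¹) (L := |K|) (M := M / theta α s) (by positivity)
    (by positivity) hβ hη₀ fun η h0 h1 => ?_
  have hηs : η < s := by linarith
  refine (le_asymmetry_ringedDisc h0 hηs).trans ((hK _ (measurableSet_ringedDisc s η)
    (ringedDisc_subset_disc h0 hηs) (hypMeasure_ringedDisc h0 hηs) _ (memBergman_testFun hα 0)
    (bergmanNorm_testFun_pos hα 0)).trans (mul_rpow_le_abs ?_ (by linarith)))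
  rw [deficit_ringedDisc hα h0 hηs, abs_div, abs_of_pos ht, div_mul_eq_mul_div]
  exact div_le_div_of_nonneg_right (hbound η h0 h1) ht.le

/-! ### Deformed discs and their deficit for small u. -/

lemma profile_mem {b : ℝ} (hb : |b| ≤ 1 / 2) (θ : ℝ) : 1 / 2 ≤ 1 + b * Real.cos (2 * θ) := by
  have h1 : |b * Real.cos (2 * θ)| ≤ 1 / 2 := by
    rw [abs_mul]
    exact (mul_le_of_le_one_right (abs_nonneg b) (Real.abs_cos_le_one _)).trans hb
  linarith [(abs_le.1 h1).1]

/-- The region `1 / (1 - r²) < (1 + b cos 2θ) / u`. -/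
def deformedDisc (b u : ℝ) : Set ℂ :=
  starRegion fun θ => Real.sqrt (1 - u / (1 + b * Real.cos (2 * θ)))

section Deformed

variable {b u : ℝ}

lemma continuous_deformed (hb : |b| ≤ 1 / 2) :
    Continuous fun θ : ℝ => u / (1 + b * Real.cos (2 * θ)) :=
  continuous_const.div (by fun_prop) fun θ => by linarith [profile_mem hb θ]

lemma deformed_pos (hb : |b| ≤ 1 / 2) (hu0 : 0 < u) (θ : ℝ) :
    0 < u / (1 + b * Real.cos (2 * θ)) :=
  div_pos hu0 (by linarith [profile_mem hb θ])

lemma deformed_le_one (hb : |b| ≤ 1 / 2) (hu1 : u ≤ 1 / 2) (θ : ℝ) :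
    u / (1 + b * Real.cos (2 * θ)) ≤ 1 := by
  have := profile_mem hb θ
  rw [div_le_one (by linarith)]
  linarith

lemma measurableSet_deformedDisc (hb : |b| ≤ 1 / 2) : MeasurableSet (deformedDisc b u) :=
  measurableSet_starRegion (continuous_const.sub (continuous_deformed hb)).sqrt.measurable

lemma deformedDisc_subset_disc (hb : |b| ≤ 1 / 2) (hu0 : 0 < u) : deformedDisc b u ⊆ disc :=
  starRegion_subset_disc fun θ => (deformed_pos hb hu0 θ).le

/-- The measure is affine in 1/(1-r²) on the boundary, so the cos 2θ perturbation contributes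
nothing. -/
lemma hypMeasure_deformedDisc (hb : |b| ≤ 1 / 2) (hu0 : 0 < u) (hu1 : u ≤ 1 / 2) :
    hypMeasure (deformedDisc b u) = ENNReal.ofReal (Real.pi * (u⁻¹ - 1)) := by
  rw [deformedDisc, hypMeasure_starRegion (continuous_deformed hb) (deformed_pos hb hu0)
    (deformed_le_one hb hu1)]
  congr 1
  have h : ∀ θ : ℝ, ((u / (1 + b * Real.cos (2 * θ)))⁻¹ - 1) / 2 =
      (u⁻¹ - 1) / 2 + u⁻¹ * b / 2 * Real.cos (2 * θ) := fun θ => by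
    rw [inv_div]; ring
  simp_rw [h]
  rw [intervalIntegral.integral_add (by simp) (by
    exact (by fun_prop : Continuous fun θ : ℝ => u⁻¹ * b / 2 * Real.cos (2 * θ)).intervalIntegrable
      _ _), intervalIntegral.integral_const_mul, integral_cos_two_mul,
    intervalIntegral.integral_const, smul_eq_mul]
  ring

end Deformed

/-- The leading coefficient of the mass of the test function outside `deformedDisc b u`. -/
def leadingMass (α ε b : ℝ) : ℝ :=
  (2 * Real.pi)⁻¹ * ∫ θ in (-Real.pi)..Real.pi,
    (1 + 2 * ε * Real.sqrt ((α + 2) * (α + 3) / 2) * Real.cos (2 * θ) +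
      ε ^ 2 * ((α + 2) * (α + 3) / 2)) * (1 + b * Real.cos (2 * θ)) ^ (-(α + 1))

lemma testFun_coeff_mul {α : ℝ} (hα : -1 < α) (ε : ℝ) :
    1 / Real.sqrt (monomialConst α 0) * (ε / Real.sqrt (monomialConst α 2)) =
      (α + 1) / Real.pi * (ε * Real.sqrt ((α + 2) * (α + 3) / 2)) := by
  have p0 := monomialConst_zero_pos hα
  have p2 := monomialConst_two_pos hα
  have a1 : 0 < α + 1 := by linarith
  have a2 : 0 < α + 2 := by linarith
  have a3 : 0 < α + 3 := by linarith
  have hpi := Real.pi_pos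
  have h : (α + 2) * (α + 3) / 2 = monomialConst α 0 / monomialConst α 2 := by
    rw [monomialConst_zero hα, monomialConst_two hα]; field_simp
  have h' : (α + 1) / Real.pi = (Real.sqrt (monomialConst α 0) ^ 2)⁻¹ := by
    rw [Real.sq_sqrt p0.le, monomialConst_zero hα, inv_div]
  have q0 := (Real.sqrt_pos.2 p0).ne'
  have q2 := (Real.sqrt_pos.2 p2).ne'
  rw [h, Real.sqrt_div p0.le, h']
  field_simp

/-- The boundary profile is u times a function of θ, so the mass outside the region is u^(α+1) times
a quadratic polynomial in u with constant term `leadingMass`. The other coefficients do not depend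
on u and drop out as u → 0. -/
lemma exists_deficit_deformedDisc_le {α : ℝ} (hα : -1 < α) (ε : ℝ) {b : ℝ} (hb : |b| ≤ 1 / 2) :
    ∃ I₁ I₂ : ℝ, ∀ s u : ℝ, 0 < s → u = (1 + s / Real.pi)⁻¹ → u ≤ 1 / 2 →
      deficit α (testFun α ε) (deformedDisc b u) ≤
        u ^ (α + 1) * (leadingMass α ε b - (1 + ε ^ 2) - I₁ * u + I₂ * u ^ 2) /
          ((1 + ε ^ 2) * (1 - u ^ (α + 1))) := by
  have hpi := Real.pi_pos
  set x := 1 / Real.sqrt (monomialConst α 0) with hx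
  set y := ε / Real.sqrt (monomialConst α 2) with hy
  have hxy : x * y = (α + 1) / Real.pi * (ε * Real.sqrt ((α + 2) * (α + 3) / 2)) :=
    testFun_coeff_mul hα ε
  have hx2 : x ^ 2 = (α + 1) / Real.pi := (testFun_sq_coeffs hα ε).1
  have hy2 : y ^ 2 = ε ^ 2 * ((α + 1) * (α + 2) * (α + 3)) / (2 * Real.pi) :=
    (testFun_sq_coeffs hα ε).2
  have hpos : ∀ θ : ℝ, 0 < 1 + b * Real.cos (2 * θ) := fun θ => by linarith [profile_mem hb θ]
  have hcontpow : ∀ q : ℝ, Continuous fun θ : ℝ => (1 + b * Real.cos (2 * θ)) ^ q := fun q =>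
    Continuous.rpow_const (by fun_prop) fun θ => Or.inl (hpos θ).ne'
  have a1 : 0 < α + 1 := by linarith
  have a2 : 0 < α + 2 := by linarith
  have a3 : 0 < α + 3 := by linarith
  refine ⟨∫ θ in (-Real.pi)..Real.pi, (2 * x * y * Real.cos (2 * θ) + 2 * y ^ 2) /
      (2 * (α + 2)) * (1 + b * Real.cos (2 * θ)) ^ (-(α + 2)),
    ∫ θ in (-Real.pi)..Real.pi, y ^ 2 / (2 * (α + 3)) *
      (1 + b * Real.cos (2 * θ)) ^ (-(α + 3)), fun s u hs hu hu1 => ?_⟩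
  have hu0 : 0 < u := hu ▸ (inv_one_add_mem hs).1
  have hsu : s = Real.pi * (u⁻¹ - 1) := by rw [hu, inv_inv]; field_simp; ring
  have hμ : hypMeasure (deformedDisc b u) = ENNReal.ofReal s := by
    rw [hypMeasure_deformedDisc hb hu0 hu1, hsu]
  have hthpos := theta_pos hα hs
  have hth : theta α s = 1 - u ^ (α + 1) := by rw [theta_eq hs, ← hu]
  rw [deficit_eq hs _ (measurableSet_deformedDisc hb) (deformedDisc_subset_disc hb hu0) hμ,
    bergmanNorm_testFun_sq hα, hth]
  rw [hth] at hthpos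
  refine div_le_div_of_nonneg_right ?_ (by positivity)
  have hL := lintegral_quadratic_starRegion hα x y (continuous_deformed hb (u := u))
    (fun θ => (deformed_pos hb hu0 θ).le) (deformed_le_one hb hu1)
  set J := ∫ θ in (-Real.pi)..Real.pi,
        (radialPrim α (x ^ 2) (2 * x * y * Real.cos (2 * θ)) (y ^ 2) 1 -
          radialPrim α (x ^ 2) (2 * x * y * Real.cos (2 * θ)) (y ^ 2)
            (u / (1 + b * Real.cos (2 * θ)))) / 2 with hJ
  -- Only this inequality is needed, so the sign of J is left open: the lower integral returns max J
  -- 0.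
  have hmass : J ≤ ∫ z in deformedDisc b u, ‖testFun α ε z‖ ^ 2 * (1 - ‖z‖ ^ 2) ^ α := by
    have hae : 0 ≤ᵐ[volume.restrict (deformedDisc b u)]
        fun z : ℂ => ‖testFun α ε z‖ ^ 2 * (1 - ‖z‖ ^ 2) ^ α :=
      (ae_restrict_iff' (measurableSet_deformedDisc hb)).2 (ae_of_all _ fun z hz =>
        weighted_nonneg α (testFun α ε) (deformedDisc_subset_disc hb hu0 hz))
    have hmeas : Measurable fun z : ℂ => ‖testFun α ε z‖ ^ 2 * (1 - ‖z‖ ^ 2) ^ α := by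
      unfold testFun; fun_prop
    have hL' : ∫⁻ z in deformedDisc b u,
        ENNReal.ofReal (‖testFun α ε z‖ ^ 2 * (1 - ‖z‖ ^ 2) ^ α) = ENNReal.ofReal J := hL
    rw [integral_eq_lintegral_of_nonneg_ae hae hmeas.aestronglyMeasurable, hL']
    rw [ENNReal.toReal_ofReal']
    exact le_max_left _ _
  refine (sub_le_sub_left hmass _).trans (le_of_eq ?_)
  have hone := integral_radialPrim_cos α (x ^ 2) (2 * x * y) (y ^ 2) 1
  rw [radialPrim_one hα] at hone
  have hq := continuous_radialPrim hα (x ^ 2) (y ^ 2)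
  have hi1 : IntervalIntegrable (fun θ : ℝ =>
      radialPrim α (x ^ 2) (2 * x * y * Real.cos (2 * θ)) (y ^ 2) 1) volume (-Real.pi) Real.pi :=
    (hq.comp (by fun_prop : Continuous fun θ : ℝ =>
      ((2 * x * y * Real.cos (2 * θ), 1) : ℝ × ℝ))).intervalIntegrable _ _
  have hi2 : IntervalIntegrable (fun θ : ℝ =>
      radialPrim α (x ^ 2) (2 * x * y * Real.cos (2 * θ)) (y ^ 2)
        (u / (1 + b * Real.cos (2 * θ)))) volume (-Real.pi) Real.pi :=
    (hq.comp (Continuous.prodMk (by fun_prop) (continuous_deformed hb))).intervalIntegrable _ _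
  have hexp : ∀ θ : ℝ, radialPrim α (x ^ 2) (2 * x * y * Real.cos (2 * θ)) (y ^ 2)
        (u / (1 + b * Real.cos (2 * θ))) =
      2 * u ^ (α + 1) * ((2 * Real.pi)⁻¹ * ((1 + 2 * ε * Real.sqrt ((α + 2) * (α + 3) / 2) *
          Real.cos (2 * θ) + ε ^ 2 * ((α + 2) * (α + 3) / 2)) *
          (1 + b * Real.cos (2 * θ)) ^ (-(α + 1))) -
        u * ((2 * x * y * Real.cos (2 * θ) + 2 * y ^ 2) /
          (2 * (α + 2)) * (1 + b * Real.cos (2 * θ)) ^ (-(α + 2))) +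
        u ^ 2 * (y ^ 2 / (2 * (α + 3)) * (1 + b * Real.cos (2 * θ)) ^ (-(α + 3)))) := by
    intro θ
    have hdiv : ∀ q : ℝ, (u / (1 + b * Real.cos (2 * θ))) ^ q =
        u ^ q * (1 + b * Real.cos (2 * θ)) ^ (-q) := fun q => by
      rw [Real.div_rpow hu0.le (hpos θ).le, Real.rpow_neg (hpos θ).le, div_eq_mul_inv]
    have e2 : u ^ (α + 2) = u ^ (α + 1) * u := by
      rw [← Real.rpow_add_one hu0.ne']; congr 1; ring
    have e3 : u ^ (α + 3) = u ^ (α + 1) * u ^ 2 := by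
      rw [← Real.rpow_two, ← Real.rpow_add hu0]; congr 1; ring
    have hlead : (x ^ 2 + 2 * x * y * Real.cos (2 * θ) + y ^ 2) / (α + 1) =
        Real.pi⁻¹ * (1 + 2 * ε * Real.sqrt ((α + 2) * (α + 3) / 2) * Real.cos (2 * θ) +
          ε ^ 2 * ((α + 2) * (α + 3) / 2)) := by
      rw [show 2 * x * y = 2 * (x * y) by ring, hxy, hx2, hy2]
      field_simp
    unfold radialPrim
    rw [hdiv, hdiv, hdiv, e2, e3]
    rw [div_eq_iff a1.ne'] at hlead
    rw [hlead]
    field_simp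
  rw [hJ, intervalIntegral.integral_div, intervalIntegral.integral_sub hi1 hi2, hone]
  simp_rw [hexp]
  rw [intervalIntegral.integral_const_mul, intervalIntegral.integral_add, intervalIntegral.integral_sub,
    intervalIntegral.integral_const_mul, intervalIntegral.integral_const_mul,
    intervalIntegral.integral_const_mul, leadingMass, hx2]
  · have : 2 * Real.pi * ((α + 1) / Real.pi / (α + 1) +
        2 * y ^ 2 / ((α + 1) * (α + 2) * (α + 3))) = 2 * (1 + ε ^ 2) := by
      rw [hy2]; field_simp
    rw [this]
    ring
  · exact (continuous_const.mul ((by fun_prop : Continuous fun θ : ℝ =>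
      1 + 2 * ε * Real.sqrt ((α + 2) * (α + 3) / 2) * Real.cos (2 * θ) +
        ε ^ 2 * ((α + 2) * (α + 3) / 2)).mul (hcontpow _))).intervalIntegrable _ _
  · exact (continuous_const.mul ((by fun_prop : Continuous fun θ : ℝ =>
      (2 * x * y * Real.cos (2 * θ) + 2 * y ^ 2) /
          (2 * (α + 2))).mul (hcontpow _))).intervalIntegrable _ _
  · exact ((continuous_const.mul ((by fun_prop : Continuous fun θ : ℝ =>
      1 + 2 * ε * Real.sqrt ((α + 2) * (α + 3) / 2) * Real.cos (2 * θ) +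
        ε ^ 2 * ((α + 2) * (α + 3) / 2)).mul (hcontpow _))).sub
      (continuous_const.mul ((by fun_prop : Continuous fun θ : ℝ =>
      (2 * x * y * Real.cos (2 * θ) + 2 * y ^ 2) /
          (2 * (α + 2))).mul (hcontpow _)))).intervalIntegrable _ _
  · exact (continuous_const.mul (continuous_const.mul (hcontpow _))).intervalIntegrable _ _

/-! ### Expansion of the leading mass and the optimal deformation. -/

lemma integral_cos_sq_two_mul :
    ∫ θ in (-Real.pi)..Real.pi, Real.cos (2 * θ) ^ 2 = Real.pi := by
  rw [intervalIntegral.integral_comp_mul_left (fun t => Real.cos t ^ 2) two_ne_zero,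
    integral_cos_sq]
  simp [Real.sin_two_pi]

/-- Pointwise form of the expansion, with c standing for cos 2θ and h for (1 + ετc)^(-p). The first
factor is at most 4, so the Taylor remainder, scaled by κ/(8(τ²+1)), costs at most ε²κ/2; the terms
of order ε³ and ε⁴ cost the other ε²κ/2. -/
lemma mul_le_of_expansion {p γ τ q ε κ c h : ℝ} (hp : 0 ≤ p) (hγ : 0 ≤ γ) (hτ : 0 ≤ τ)
    (hq : 0 ≤ q) (hε : 0 ≤ ε) (hε1 : ε ≤ 1 / 2) (hεγ : ε * γ ≤ 1) (hκ : 0 ≤ κ)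
    (hεK : ε * (p * τ * γ ^ 2 + 2 * q * τ ^ 2 * γ + q * τ ^ 2 * γ ^ 2) ≤ κ / 2) (hc : |c| ≤ 1)
    (hh : h ≤ κ / (8 * (τ ^ 2 + 1)) * (ε * τ * c) ^ 2 +
      (1 - p * (ε * τ * c) + q * (ε * τ * c) ^ 2)) :
    (1 + 2 * ε * γ * c + ε ^ 2 * γ ^ 2) * h ≤
      (1 + ε ^ 2 * γ ^ 2 + ε ^ 2 * κ) + ε * (2 * γ - p * τ) * c +
        ε ^ 2 * (q * τ ^ 2 - 2 * p * τ * γ) * c ^ 2 := by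
  obtain ⟨hcl, hcu⟩ := abs_le.1 hc
  have hεγ0 : 0 ≤ ε * γ := by positivity
  have hW0 : 0 ≤ 1 + 2 * ε * γ * c + ε ^ 2 * γ ^ 2 := by
    have := mul_nonneg hεγ0 (by linarith : 0 ≤ 1 + c)
    linarith [sq_nonneg (1 - ε * γ)]
  have hW4 : 1 + 2 * ε * γ * c + ε ^ 2 * γ ^ 2 ≤ 4 := by
    have h1 := mul_nonneg hεγ0 (by linarith : 0 ≤ 1 - c)
    have h2 := mul_nonneg hεγ0 (by linarith : 0 ≤ 1 - ε * γ)
    linarith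
  have hc2 : c ^ 2 ≤ 1 := (sq_le_one_iff_abs_le_one c).2 hc
  have hrem : (1 + 2 * ε * γ * c + ε ^ 2 * γ ^ 2) *
      (κ / (8 * (τ ^ 2 + 1)) * (ε * τ * c) ^ 2) ≤ ε ^ 2 * (κ / 2) := by
    have h2 : κ / (8 * (τ ^ 2 + 1)) * (ε * τ * c) ^ 2 ≤ ε ^ 2 * (κ / 8) := by
      rw [div_mul_eq_mul_div, div_le_iff₀ (by positivity)]
      have h3 : τ ^ 2 * c ^ 2 ≤ τ ^ 2 + 1 := by
        have := mul_le_of_le_one_right (sq_nonneg τ) hc2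
        linarith
      have := mul_le_mul_of_nonneg_left h3 (mul_nonneg hκ (sq_nonneg ε))
      linarith
    calc _ ≤ 4 * (ε ^ 2 * (κ / 8)) := mul_le_mul hW4 h2 (by positivity) (by norm_num)
      _ = _ := by ring
  have hcub : ε ^ 3 * (-(p * τ * γ ^ 2) * c + 2 * q * τ ^ 2 * γ * c ^ 3) +
      ε ^ 4 * (q * τ ^ 2 * γ ^ 2) * c ^ 2 ≤ ε ^ 2 * (κ / 2) := by
    have h3 : -(p * τ * γ ^ 2) * c ≤ p * τ * γ ^ 2 := by
      have := mul_nonneg (by positivity : 0 ≤ p * τ * γ ^ 2) (by linarith : 0 ≤ 1 + c)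
      linarith
    have hc3 : c ^ 3 ≤ 1 := by
      have := mul_le_mul_of_nonneg_left hcu (sq_nonneg c)
      linarith [this, pow_succ c 2]
    have h4 : 2 * q * τ ^ 2 * γ * c ^ 3 ≤ 2 * q * τ ^ 2 * γ :=
      mul_le_of_le_one_right (by positivity) hc3
    have h5 : q * τ ^ 2 * γ ^ 2 * (ε * c ^ 2) ≤ q * τ ^ 2 * γ ^ 2 :=
      mul_le_of_le_one_right (by positivity)
        ((mul_le_of_le_one_right hε hc2).trans (by linarith))
    calc _ = ε ^ 3 * (-(p * τ * γ ^ 2) * c + 2 * q * τ ^ 2 * γ * c ^ 3 +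
          q * τ ^ 2 * γ ^ 2 * (ε * c ^ 2)) := by ring
      _ ≤ ε ^ 3 * (p * τ * γ ^ 2 + 2 * q * τ ^ 2 * γ + q * τ ^ 2 * γ ^ 2) :=
        mul_le_mul_of_nonneg_left (by linarith) (by positivity)
      _ = ε ^ 2 * (ε * (p * τ * γ ^ 2 + 2 * q * τ ^ 2 * γ + q * τ ^ 2 * γ ^ 2)) := by ring
      _ ≤ _ := mul_le_mul_of_nonneg_left hεK (by positivity)
  refine (mul_le_mul_of_nonneg_left hh hW0).trans ?_
  rw [mul_add]
  linear_combination hrem + hcub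

/-- Second order expansion of the leading mass for the optimal deformation. -/
lemma leadingMass_le {α : ℝ} (hα : -1 < α) {κ : ℝ} (hκ : 0 < κ) :
    ∃ ε b : ℝ, 0 < ε ∧ ε ≤ 1 / 2 ∧ |b| ≤ 1 / 2 ∧
      leadingMass α ε b - (1 + ε ^ 2) ≤ ε ^ 2 * ((α + 1) / 2 + κ) := by
  have hpi := Real.pi_pos
  have a1 : 0 < α + 1 := by linarith
  have a2 : 0 < α + 2 := by linarith
  have a3 : 0 < α + 3 := by linarith
  set γ := Real.sqrt ((α + 2) * (α + 3) / 2) with hγ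
  have hγ0 : 0 ≤ γ := Real.sqrt_nonneg _
  have hγ2 : (α + 2) * (α + 3) / 2 = γ ^ 2 := (Real.sq_sqrt (by positivity)).symm
  -- With b = ετ, averaging gives the ε² coefficient γ² + (qτ² - 2(α+1)τγ)/2. This τ minimizes it,
  -- with minimum (α+3)/2; subtracting the 1 from the norm leaves (α+1)/2.
  set τ := 2 * γ / (α + 2) with hτ
  have hτ0 : 0 ≤ τ := by positivity
  set q := (α + 1) * (α + 1 + 1) / 2 with hq
  have hq0 : 0 ≤ q := by positivity
  set K := (α + 1) * τ * γ ^ 2 + 2 * q * τ ^ 2 * γ + q * τ ^ 2 * γ ^ 2 with hK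
  have hK0 : 0 ≤ K := by positivity
  obtain ⟨d, hd0, hd1, hd⟩ := abs_one_add_rpow_sub_le (α + 1)
    (by positivity : 0 < κ / (8 * (τ ^ 2 + 1)))
  obtain ⟨ε, hε0, hε⟩ : ∃ ε : ℝ, 0 < ε ∧ ε ≤ 1 / 2 ∧ ε * τ ≤ min d (1 / 2) ∧ ε * γ ≤ 1 ∧
      ε * K ≤ κ / 2 := by
    have hev : ∀ (m l : ℝ), 0 < l → ∀ᶠ ε in 𝓝[>] (0 : ℝ), ε * m ≤ l := fun m l hl => by
      have h1 : Tendsto (fun ε : ℝ => ε * m) (𝓝[>] 0) (𝓝 0) := by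
        have := (by fun_prop : Continuous fun ε : ℝ => ε * m).tendsto 0
        rw [zero_mul] at this
        exact this.mono_left nhdsWithin_le_nhds
      exact (h1.eventually (gt_mem_nhds hl)).mono fun _ => le_of_lt
    obtain ⟨ε, h1, h2, h3, h4, h5⟩ := ((eventually_mem_nhdsWithin (a := (0 : ℝ)) (s := Ioi 0)).and
      ((hev 1 (1 / 2) (by norm_num)).and ((hev τ (min d (1 / 2)) (by positivity)).and
        ((hev γ 1 one_pos).and (hev K (κ / 2) (by positivity)))))).exists
    exact ⟨ε, h1, by linarith, h3, h4, h5⟩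
  obtain ⟨hε1, hετ, hεγ, hεK⟩ := hε
  have hb : |ε * τ| ≤ 1 / 2 := by
    rw [abs_of_nonneg (by positivity)]; exact hετ.trans (min_le_right _ _)
  refine ⟨ε, ε * τ, hε0, hε1, hb, ?_⟩
  have hpt : ∀ θ : ℝ, (1 + 2 * ε * γ * Real.cos (2 * θ) + ε ^ 2 * γ ^ 2) *
      (1 + ε * τ * Real.cos (2 * θ)) ^ (-(α + 1)) ≤
      (1 + ε ^ 2 * γ ^ 2 + ε ^ 2 * κ) + ε * (2 * γ - (α + 1) * τ) * Real.cos (2 * θ) +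
        ε ^ 2 * (q * τ ^ 2 - 2 * (α + 1) * τ * γ) * Real.cos (2 * θ) ^ 2 := by
    intro θ
    have hc := Real.abs_cos_le_one (2 * θ)
    have hxd : |ε * τ * Real.cos (2 * θ)| ≤ d := by
      rw [abs_mul, abs_of_nonneg (by positivity : 0 ≤ ε * τ)]
      exact (mul_le_of_le_one_right (by positivity) hc).trans (hετ.trans (min_le_left _ _))
    exact mul_le_of_expansion a1.le hγ0 hτ0 hq0 hε0.le hε1 hεγ hκ.le hεK hc
      (sub_le_iff_le_add.1 (abs_le.1 (hd _ hxd)).2)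
  have hpos : ∀ θ : ℝ, 0 < 1 + ε * τ * Real.cos (2 * θ) := fun θ => by
    linarith [profile_mem hb θ]
  have hcontpow : Continuous fun θ : ℝ => (1 + ε * τ * Real.cos (2 * θ)) ^ (-(α + 1)) :=
    Continuous.rpow_const (by fun_prop) fun θ => Or.inl (hpos θ).ne'
  have hintegral := intervalIntegral.integral_mono (μ := volume) (by linarith : -Real.pi ≤ Real.pi)
    (((by fun_prop : Continuous fun θ : ℝ =>
      1 + 2 * ε * γ * Real.cos (2 * θ) + ε ^ 2 * γ ^ 2).mul hcontpow).intervalIntegrable _ _)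
    ((by fun_prop : Continuous fun θ : ℝ => (1 + ε ^ 2 * γ ^ 2 + ε ^ 2 * κ) +
      ε * (2 * γ - (α + 1) * τ) * Real.cos (2 * θ) +
        ε ^ 2 * (q * τ ^ 2 - 2 * (α + 1) * τ * γ) *
          Real.cos (2 * θ) ^ 2).intervalIntegrable _ _) hpt
  rw [intervalIntegral.integral_add ((by fun_prop : Continuous fun θ : ℝ =>
      (1 + ε ^ 2 * γ ^ 2 + ε ^ 2 * κ) +
        ε * (2 * γ - (α + 1) * τ) * Real.cos (2 * θ)).intervalIntegrable _ _)
      ((by fun_prop : Continuous fun θ : ℝ => ε ^ 2 * (q * τ ^ 2 - 2 * (α + 1) * τ * γ) *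
          Real.cos (2 * θ) ^ 2).intervalIntegrable _ _),
    intervalIntegral.integral_add (by simp) ((by fun_prop : Continuous fun θ : ℝ =>
        ε * (2 * γ - (α + 1) * τ) * Real.cos (2 * θ)).intervalIntegrable _ _),
    intervalIntegral.integral_const_mul, intervalIntegral.integral_const_mul,
    integral_cos_two_mul, integral_cos_sq_two_mul, intervalIntegral.integral_const,
    smul_eq_mul] at hintegral
  have hτ1 : (α + 2) * τ = 2 * γ := by rw [hτ]; field_simp
  have hval : γ ^ 2 + (q * τ ^ 2 - 2 * (α + 1) * τ * γ) / 2 = (α + 3) / 2 := by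
    have h1 : γ = (α + 2) * τ / 2 := by linarith
    have h2 : (α + 2) * τ ^ 2 = 2 * (α + 3) := by
      have : (α + 2) * ((α + 2) * τ ^ 2) = (α + 2) * (2 * (α + 3)) := by
        have : ((α + 2) * τ) ^ 2 = 4 * γ ^ 2 := by rw [hτ1]; ring
        rw [← hγ2] at this
        linarith
      exact mul_left_cancel₀ a2.ne' this
    rw [h1, hq]
    linear_combination (1 / 4) * h2
  rw [leadingMass, ← hγ, hγ2]
  have hmul := mul_le_mul_of_nonneg_left hintegral (by positivity : 0 ≤ (2 * Real.pi)⁻¹)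
  refine (sub_le_sub_right hmul _).trans (le_of_eq ?_)
  field_simp
  linear_combination 2 * Real.pi * ε ^ 2 * hval

/-! ### Large sets: lower bounds for c. -/

/-- Real square roots vanish on nonpositive numbers, so a positive left side forces both the
radicand and the deficit to be positive. -/
lemma sq_le_of_le_sqrt_mul {D C X δ : ℝ} (hD : 0 < D)
    (h : D ≤ C * Real.sqrt X * δ ^ (1 / 2 : ℝ)) : 0 < X ∧ 0 < δ ∧ D ^ 2 ≤ C ^ 2 * X * δ := by
  rw [← Real.sqrt_eq_rpow] at h
  have hX : 0 < X := by
    by_contra! hX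
    rw [Real.sqrt_eq_zero_of_nonpos hX] at h
    linarith [h, mul_zero C, zero_mul (Real.sqrt δ)]
  have hδ : 0 < δ := by
    by_contra! hδ
    rw [Real.sqrt_eq_zero_of_nonpos hδ, mul_zero] at h
    linarith
  refine ⟨hX, hδ, (pow_le_pow_left₀ hD.le h 2).trans (le_of_eq ?_)⟩
  rw [mul_pow, mul_pow, Real.sq_sqrt hX.le, Real.sq_sqrt hδ.le]

lemma one_add_mul_eq {u c s : ℝ} (hs : s = Real.pi * (u⁻¹ - 1)) :
    1 + c * (s / Real.pi) = 1 + c * (u⁻¹ - 1) := by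
  rw [hs, mul_div_cancel_left₀ _ Real.pi_pos.ne']

lemma eq_inv_one_add {u s : ℝ} (hs : s = Real.pi * (u⁻¹ - 1)) : u = (1 + s / Real.pi)⁻¹ := by
  rw [hs, mul_div_cancel_left₀ _ Real.pi_pos.ne', add_sub_cancel, inv_inv]

lemma pos_of_eq {u s : ℝ} (hs : s = Real.pi * (u⁻¹ - 1)) (hu0 : 0 < u) (hu1 : u < 1) : 0 < s := by
  rw [hs]
  exact mul_pos Real.pi_pos (sub_pos.2 ((one_lt_inv₀ hu0).2 hu1))

/-- The limit of the function estimate as the measure tends to infinity. -/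
lemma extremalDist_sq_le_of_estimate {α c C : ℝ} (hα : -1 < α) (hc : 0 ≤ c)
    (h : ∀ s : ℝ, 0 < s → FunctionEstimate α s (C * sigmaConst c α s) (1 / 2))
    {ε b : ℝ} (hε0 : 0 < ε) (hε1 : ε ≤ 1 / 2) (hb : |b| ≤ 1 / 2) :
    extremalDist α (testFun α ε) ^ 2 ≤ C ^ 2 * ((α + 2) / (α + 1) * c ^ (α + 1)) *
      ((leadingMass α ε b - (1 + ε ^ 2)) / (1 + ε ^ 2)) := by
  have a1 : 0 < α + 1 := by linarith
  obtain ⟨I₁, I₂, hI⟩ := exists_deficit_deformedDisc_le hα ε hb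
  have hpow : Tendsto (fun u : ℝ => u ^ (α + 1)) (𝓝 0) (𝓝 0) := by
    have := (Real.continuous_rpow_const a1.le).tendsto (0 : ℝ)
    rwa [Real.zero_rpow a1.ne'] at this
  have hpow2 : Tendsto (fun u : ℝ => (u + c * (1 - u)) ^ (α + 1)) (𝓝 0) (𝓝 (c ^ (α + 1))) := by
    have := ((Real.continuous_rpow_const a1.le).comp
      (by fun_prop : Continuous fun u : ℝ => u + c * (1 - u))).tendsto (0 : ℝ)
    simpa [Function.comp_def] using this
  have hpoly : Tendsto (fun u : ℝ => leadingMass α ε b - (1 + ε ^ 2) - I₁ * u + I₂ * u ^ 2) (𝓝 0)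
      (𝓝 (leadingMass α ε b - (1 + ε ^ 2))) := by
    have := (by fun_prop : Continuous fun u : ℝ =>
      leadingMass α ε b - (1 + ε ^ 2) - I₁ * u + I₂ * u ^ 2).tendsto 0
    simpa using this
  have hN : (1 + ε ^ 2) * (1 - 0) ≠ 0 := by positivity
  -- The factor u^(α+1) of the deficit is moved into the squared constant, using u(1 + c(u⁻¹-1)) = u
  -- + c(1-u); each factor then converges as u → 0.
  have hlim : Tendsto (fun u : ℝ =>
      C ^ 2 * (u ^ (α + 1) + (α + 2) / (α + 1) * ((u + c * (1 - u)) ^ (α + 1) - u ^ (α + 1))) *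
        ((leadingMass α ε b - (1 + ε ^ 2) - I₁ * u + I₂ * u ^ 2) /
          ((1 + ε ^ 2) * (1 - u ^ (α + 1))))) (𝓝[>] 0)
      (𝓝 (C ^ 2 * (0 + (α + 2) / (α + 1) * (c ^ (α + 1) - 0)) *
        ((leadingMass α ε b - (1 + ε ^ 2)) / ((1 + ε ^ 2) * (1 - 0))))) :=
    (((hpow.add ((hpow2.sub hpow).const_mul _)).const_mul _).mul
      (hpoly.div ((hpow.const_sub 1).const_mul _) hN)).mono_left nhdsWithin_le_nhds
  rw [zero_add, sub_zero, sub_zero, mul_one] at hlim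
  refine ge_of_tendsto hlim ?_
  filter_upwards [Ioc_mem_nhdsGT (by norm_num : (0 : ℝ) < 1 / 2)] with u hu
  obtain ⟨hu0, hu1⟩ := hu
  obtain ⟨s, hs⟩ : ∃ s, s = Real.pi * (u⁻¹ - 1) := ⟨_, rfl⟩
  have hs0 := pos_of_eq hs hu0 (by linarith)
  have hest := h s hs0 _ (measurableSet_deformedDisc hb (u := u)) (deformedDisc_subset_disc hb hu0)
    (by rw [hypMeasure_deformedDisc hb hu0 hu1, hs]) _ (memBergman_testFun hα ε)
    (bergmanNorm_testFun_pos hα ε)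
  obtain ⟨hX, -, hle⟩ := sq_le_of_le_sqrt_mul (extremalDist_testFun_pos hα hε0 hε1) hest
  refine hle.trans ((mul_le_mul_of_nonneg_left (hI s u hs0 (eq_inv_one_add hs) hu1)
    (by positivity)).trans (le_of_eq ?_))
  rw [one_add_mul_eq hs]
  have hsplit : u + c * (1 - u) = u * (1 + c * (u⁻¹ - 1)) := by field_simp
  have hnn : 0 ≤ 1 + c * (u⁻¹ - 1) := by
    have : 0 ≤ c * (u⁻¹ - 1) :=
      mul_nonneg hc (sub_nonneg.2 ((one_le_inv₀ hu0).2 (by linarith)))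
    linarith
  rw [hsplit, Real.mul_rpow hu0.le hnn]
  ring

lemma one_le_of_estimate {α c C : ℝ} (hα : -1 < α)
    (h : ∀ s : ℝ, 0 < s → FunctionEstimate α s (C * sigmaConst c α s) (1 / 2)) :
    0 ≤ c ∧ 1 ≤ C ^ 2 * (α + 2) / 2 * c ^ (α + 1) := by
  have a1 : 0 < α + 1 := by linarith
  have a2 : 0 < α + 2 := by linarith
  -- If c < 0, then s = -π/c makes 1 + cs/π vanish; the radicand becomes 1 - (α+2)/(α+1) < 0, while
  -- the distance is positive.
  have hc : 0 ≤ c := by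
    by_contra! hc
    have hpi := Real.pi_pos
    have hs : 0 < -(Real.pi / c) := neg_pos.2 (div_neg_of_pos_of_neg hpi hc)
    have hest := h _ hs _ (measurableSet_centredDisc _) (centredDisc_subset_disc hs)
      (hypMeasure_centredDisc hs) _ (memBergman_testFun hα (1 / 2))
      (bergmanNorm_testFun_pos hα (1 / 2))
    have hX := (sq_le_of_le_sqrt_mul (extremalDist_testFun_pos hα (by norm_num) le_rfl) hest).1
    have h0 : 1 + c * (-(Real.pi / c) / Real.pi) = 0 := by
      have := hc.ne
      have := hpi.ne'
      field_simp
      ring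
    rw [h0, Real.zero_rpow a1.ne'] at hX
    have : 1 < (α + 2) / (α + 1) := (one_lt_div a1).2 (by linarith)
    linarith
  refine ⟨hc, ?_⟩
  set M := C ^ 2 * ((α + 2) / (α + 1) * c ^ (α + 1)) with hM
  have hM0 : 0 ≤ M := by have := Real.rpow_nonneg hc (α + 1); positivity
  have hκ : ∀ κ > 0, 1 ≤ M * ((α + 1) / 2 + κ) := by
    intro κ hκ
    obtain ⟨ε, b, hε0, hε1, hb, hle⟩ := leadingMass_le hα hκ
    have h1 := extremalDist_sq_le_of_estimate hα hc h hε0 hε1 hb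
    rw [extremalDist_testFun_sq hα hε0.le hε1] at h1
    have h2 : M * ((leadingMass α ε b - (1 + ε ^ 2)) / (1 + ε ^ 2)) ≤
        M * (ε ^ 2 * ((α + 1) / 2 + κ) / (1 + ε ^ 2)) := by gcongr
    have h3 := h1.trans h2
    have hN1 : 1 ≤ Real.sqrt (1 + ε ^ 2) := Real.one_le_sqrt.2 (by linarith [sq_nonneg ε])
    have hN2 : Real.sqrt (1 + ε ^ 2) ^ 2 = 1 + ε ^ 2 := Real.sq_sqrt (by positivity)
    rw [← mul_div_assoc, ← mul_left_comm, le_div_iff₀ (by positivity)] at h3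
    have hε2 : 0 < ε ^ 2 := by positivity
    -- Since N ≥ 1, N(N+1) ≤ 2N², that is, the squared distance is at least ε²/(1+ε²).
    have h4 : ε ^ 2 * 1 ≤ 2 * ε ^ 2 / (Real.sqrt (1 + ε ^ 2) * (Real.sqrt (1 + ε ^ 2) + 1)) *
        (1 + ε ^ 2) := by
      rw [div_mul_eq_mul_div, le_div_iff₀ (by positivity)]
      have h5 : Real.sqrt (1 + ε ^ 2) * (Real.sqrt (1 + ε ^ 2) + 1) ≤ 2 * (1 + ε ^ 2) := by
        nlinarith
      nlinarith
    exact le_of_mul_le_mul_left (h4.trans h3) hε2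
  have hlim : Tendsto (fun κ : ℝ => M * ((α + 1) / 2 + κ)) (𝓝[>] 0) (𝓝 (M * ((α + 1) / 2))) := by
    have := (by fun_prop : Continuous fun κ : ℝ => M * ((α + 1) / 2 + κ)).tendsto 0
    rw [add_zero] at this
    exact this.mono_left nhdsWithin_le_nhds
  refine (ge_of_tendsto hlim (eventually_nhdsWithin_of_forall hκ)).trans (le_of_eq ?_)
  rw [hM]
  field_simp

lemma rpow_neg_inv_le_of_one_le_mul {A c p : ℝ} (hA : 0 < A) (hc : 0 ≤ c) (hp : 0 < p)
    (h : 1 ≤ A * c ^ p) : A ^ (-(1 / p)) ≤ c := by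
  have h1 : A⁻¹ ≤ c ^ p := by
    rw [inv_eq_one_div, div_le_iff₀ hA]; linarith
  calc A ^ (-(1 / p)) = A⁻¹ ^ (1 / p) := by rw [Real.rpow_neg hA.le, Real.inv_rpow hA.le]
    _ ≤ (c ^ p) ^ (1 / p) := Real.rpow_le_rpow (by positivity) h1 (by positivity)
    _ = c := by rw [← Real.rpow_mul hc, mul_one_div_cancel hp.ne', Real.rpow_one]

lemma FunctionEstimate.mono {α s K K' : ℝ} (h : FunctionEstimate α s K (1 / 2)) (hK : K ≤ K') :
    FunctionEstimate α s K' (1 / 2) := fun Ω h1 h2 h3 f h4 h5 =>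
  (h Ω h1 h2 h3 f h4 h5).trans (mul_le_mul_of_nonneg_right hK
    (by rw [← Real.sqrt_eq_rpow]; exact Real.sqrt_nonneg _))

/-- Along integers α = n the necessary condition bounds a multiple of (n+2)c^(n+1) below by 1, but
for 0 ≤ c < 1 this tends to 0. -/
lemma not_eventually_estimate {c : ℝ} (hc : c < 1) (C : ℝ) :
    ¬ ∀ᶠ α : ℝ in atTop, ∀ s : ℝ, 0 < s →
        FunctionEstimate α s (C * sigmaConst c α s) (1 / 2) := by
  intro h
  set C' := max C 1
  have h1 : ∀ᶠ n : ℕ in atTop, 0 ≤ c ∧ 1 ≤ C' ^ 2 / 2 * ((n + 2) * c ^ (n + 1)) := by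
    filter_upwards [tendsto_natCast_atTop_atTop.eventually h] with n hn
    have hn' : ∀ s : ℝ, 0 < s → FunctionEstimate n s (C' * sigmaConst c n s) (1 / 2) :=
      fun s hs => (hn s hs).mono
        (mul_le_mul_of_nonneg_right (le_max_left _ _) (Real.sqrt_nonneg _))
    obtain ⟨h0, hle⟩ := one_le_of_estimate (by linarith [Nat.cast_nonneg (α := ℝ) n]) hn'
    refine ⟨h0, hle.trans (le_of_eq ?_)⟩
    rw [show ((n : ℝ) + 1) = ((n + 1 : ℕ) : ℝ) by push_cast; rfl, Real.rpow_natCast]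
    ring
  obtain ⟨-, hc0, -⟩ := h1.exists
  have hlim : Tendsto (fun n : ℕ => C' ^ 2 / 2 * (((n : ℝ) + 2) * c ^ (n + 1))) atTop
      (𝓝 (C' ^ 2 / 2 * ((0 + 2 * 0) * c))) := by
    have t1 := tendsto_self_mul_const_pow_of_lt_one hc0 hc
    have t2 := (tendsto_pow_atTop_nhds_zero_of_lt_one hc0 hc).const_mul 2
    refine (((t1.add t2).mul_const c).const_mul (C' ^ 2 / 2)).congr fun n => ?_
    ring
  have := ge_of_tendsto hlim (h1.mono fun _ => And.right)
  norm_num at this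

/-! ### Small sets: the constant C = 1. -/

lemma tendsto_one_sub_div (p : ℝ) :
    Tendsto (fun u : ℝ => (1 - u ^ p) / (1 - u)) (𝓝[<] 1) (𝓝 p) := by
  have h := (Real.hasDerivAt_rpow_const (x := 1) (p := p) (Or.inl one_ne_zero)).tendsto_slope
  rw [Real.one_rpow, mul_one] at h
  refine (h.mono_left (nhdsWithin_mono _ fun u hu => ne_of_lt hu)).congr fun u => ?_
  rw [slope_def_field, Real.one_rpow, ← neg_sub 1 (u ^ p), ← neg_sub 1 u, neg_div_neg_eq]

/-- The limit of the function estimate as the measure tends to `0` excludes the constant `1`. -/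
lemma not_estimate_one {α : ℝ} (hα : -1 < α) (c : ℝ) :
    ¬ ∀ s : ℝ, 0 < s → FunctionEstimate α s (sigmaConst c α s) (1 / 2) := by
  intro h
  have a1 : 0 < α + 1 := by linarith
  obtain ⟨ε, hε0, hε1⟩ : ∃ ε : ℝ, 0 < ε ∧ ε ≤ 1 / 2 := ⟨1 / 2, by norm_num, le_rfl⟩
  have hX : Tendsto (fun u : ℝ => 1 + (α + 2) / (α + 1) * ((1 + c * (u⁻¹ - 1)) ^ (α + 1) - 1))
      (𝓝[<] 1) (𝓝 1) := by
    have hca : ContinuousAt (fun u : ℝ =>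
        1 + (α + 2) / (α + 1) * ((1 + c * (u⁻¹ - 1)) ^ (α + 1) - 1)) 1 := by
      have h1 : ContinuousAt (fun u : ℝ => 1 + c * (u⁻¹ - 1)) 1 :=
        continuousAt_const.add (continuousAt_const.mul
          ((continuousAt_inv₀ one_ne_zero).sub continuousAt_const))
      have h2 := h1.rpow_const (p := α + 1) (Or.inl (by norm_num))
      exact continuousAt_const.add (continuousAt_const.mul (h2.sub continuousAt_const))
    have := hca.tendsto
    simp only [inv_one, sub_self, mul_zero, add_zero, Real.one_rpow] at this
    exact this.mono_left nhdsWithin_le_nhds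
  -- The factor 1 - u is paired with 1 - u^(α+1), whose quotient tends to α + 1; the deficit factor
  -- thus tends to 1, and Σ² does too.
  have hG : Tendsto (fun u : ℝ => u ^ (α + 1) * ((α + 1) / 2 * (α + 4 - (α + 2) * u)) /
      ((1 - u ^ (α + 1)) / (1 - u))) (𝓝[<] 1)
      (𝓝 ((1 : ℝ) ^ (α + 1) * ((α + 1) / 2 * (α + 4 - (α + 2) * 1)) / (α + 1))) := by
    refine Tendsto.div ?_ (tendsto_one_sub_div _) a1.ne'
    have : Continuous fun u : ℝ => u ^ (α + 1) * ((α + 1) / 2 * (α + 4 - (α + 2) * u)) :=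
      (Real.continuous_rpow_const a1.le).mul (by fun_prop)
    exact (this.tendsto 1).mono_left nhdsWithin_le_nhds
  have hval : (1 : ℝ) ^ (α + 1) * ((α + 1) / 2 * (α + 4 - (α + 2) * 1)) / (α + 1) = 1 := by
    rw [Real.one_rpow]; field_simp; ring
  rw [hval] at hG
  have hlim := hX.mul (hG.const_mul (ε ^ 2 / (1 + ε ^ 2)))
  have hle : extremalDist α (testFun α ε) ^ 2 ≤ 1 * (ε ^ 2 / (1 + ε ^ 2) * 1) := by
    refine ge_of_tendsto hlim ?_
    filter_upwards [Ioo_mem_nhdsLT (zero_lt_one' ℝ)] with u hu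
    obtain ⟨s, hs⟩ : ∃ s, s = Real.pi * (u⁻¹ - 1) := ⟨_, rfl⟩
    have hs0 := pos_of_eq hs hu.1 hu.2
    have hest := h s hs0 _ (measurableSet_centredDisc s) (centredDisc_subset_disc hs0)
      (hypMeasure_centredDisc hs0) _ (memBergman_testFun hα ε) (bergmanNorm_testFun_pos hα ε)
    rw [← one_mul (sigmaConst c α s)] at hest
    have hfin := (sq_le_of_le_sqrt_mul (extremalDist_testFun_pos hα hε0 hε1) hest).2.2
    rw [deficit_testFun_centredDisc hα ε hs0 (eq_inv_one_add hs), one_add_mul_eq hs, one_pow,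
      one_mul] at hfin
    refine hfin.trans (le_of_eq ?_)
    rw [div_div_eq_mul_div]
    ring
  rw [extremalDist_testFun_sq hα hε0.le hε1, one_mul, mul_one,
    div_le_div_iff₀ (by positivity) (by positivity)] at hle
  -- The limiting inequality reads 2/(N(N+1)) ≤ 1/N², that is N ≤ 1, which is false for ε > 0.
  have hN1 : 1 < Real.sqrt (1 + ε ^ 2) := Real.lt_sqrt_of_sq_lt (by nlinarith)
  have hN2 : Real.sqrt (1 + ε ^ 2) ^ 2 = 1 + ε ^ 2 := Real.sq_sqrt (by positivity)
  have hε2 : 0 < ε ^ 2 := by positivity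
  have h5 : 2 * (1 + ε ^ 2) ≤ Real.sqrt (1 + ε ^ 2) * (Real.sqrt (1 + ε ^ 2) + 1) :=
    le_of_mul_le_mul_left (by linarith) hε2
  nlinarith

/-! ### The joint limit α → -1, ε → 0. -/

section SmallWeight

lemma tendsto_extremalDist_div :
    Tendsto (fun p : ℝ × ℝ => extremalDist p.1 (testFun p.1 p.2) / p.2)
      (𝓝[>] (-1) ×ˢ 𝓝[>] 0) (𝓝 1) := by
  have h1 : Tendsto (fun ε : ℝ => Real.sqrt (2 / (Real.sqrt (1 + ε ^ 2) *
      (Real.sqrt (1 + ε ^ 2) + 1)))) (𝓝[>] 0) (𝓝 1) := by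
    have hc : Continuous fun ε : ℝ => Real.sqrt (2 / (Real.sqrt (1 + ε ^ 2) *
      (Real.sqrt (1 + ε ^ 2) + 1))) :=
      (continuous_const.div (by fun_prop) fun ε => by positivity).sqrt
    have h0 := hc.tendsto 0
    rw [show Real.sqrt (2 / (Real.sqrt (1 + 0 ^ 2) * (Real.sqrt (1 + 0 ^ 2) + 1))) = 1 by
      norm_num] at h0
    exact h0.mono_left nhdsWithin_le_nhds
  refine (h1.comp tendsto_snd).congr' ?_
  have hα : ∀ᶠ α in 𝓝[>] (-1 : ℝ), -1 < α := eventually_mem_nhdsWithin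
  have hε : ∀ᶠ ε in 𝓝[>] (0 : ℝ), ε ∈ Ioc (0 : ℝ) (1 / 2) := Ioc_mem_nhdsGT (by norm_num)
  filter_upwards [hα.prod_mk hε] with p hp
  obtain ⟨h1, h2, h3⟩ := hp
  have h4 := extremalDist_testFun_sq h1 h2.le h3
  rw [Function.comp_apply, eq_div_iff h2.ne', ← Real.sqrt_sq (extremalDist_nonneg p.1 _), h4]
  nth_rewrite 3 [← Real.sqrt_sq h2.le]
  rw [← Real.sqrt_mul' _ (sq_nonneg _)]
  congr 1
  ring

/-- The difference quotient at exponent 0 of x ↦ t^x. -/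
lemma tendsto_rpow_sub_one_div {t : ℝ} (ht : 0 < t) :
    Tendsto (fun α : ℝ => (t ^ (α + 1) - 1) / (α + 1)) (𝓝[>] (-1)) (𝓝 (Real.log t)) := by
  have h := (Real.hasStrictDerivAt_const_rpow ht 0).hasDerivAt.tendsto_slope
  rw [Real.rpow_zero, one_mul] at h
  have h2 : Tendsto (fun α : ℝ => α + 1) (𝓝[>] (-1)) (𝓝[≠] 0) := by
    refine tendsto_nhdsWithin_iff.2 ⟨?_, ?_⟩
    · have := (by fun_prop : Continuous fun α : ℝ => α + 1).tendsto (-1)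
      rw [neg_add_cancel] at this
      exact this.mono_left nhdsWithin_le_nhds
    · filter_upwards [self_mem_nhdsWithin] with α hα
      have : -1 < α := hα
      exact (by linarith : α + 1 ≠ 0)
  refine (h.comp h2).congr fun α => ?_
  simp [slope_def_field]

/-- The limit of `Σ² δ / ε²` as the weight tends to `-1`, for `u = 1 / (1 + s / π)`. -/
def limitRatio (u : ℝ) : ℝ :=
  (1 - Real.log u) * ((1 - u) * (3 - u) / 2 / (-Real.log u))

/-- With L = -log u, the bounds 1 - u ≤ L and u(1+L) ≤ 1 give L ≤ (1+L)(1-u) ≤ 2L; the remaining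
factor 3 - u lies between 2 and 3. -/
lemma limitRatio_mem {u : ℝ} (hu0 : 0 < u) (hu1 : u < 1) :
    1 ≤ limitRatio u ∧ limitRatio u ≤ 3 := by
  have hL : Real.log u < 0 := Real.log_neg hu0 hu1
  have h1 : Real.log u ≤ u - 1 := Real.log_le_sub_one_of_pos hu0
  have h2 : Real.log u⁻¹ ≤ u⁻¹ - 1 := Real.log_le_sub_one_of_pos (inv_pos.2 hu0)
  rw [Real.log_inv] at h2
  have h3 : u * (1 - Real.log u) ≤ 1 := by
    have := mul_le_mul_of_nonneg_left h2 hu0.le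
    rw [mul_sub, mul_inv_cancel₀ hu0.ne'] at this
    linarith
  set L := -Real.log u
  have hLdef : Real.log u = -L := by simp [L]
  rw [hLdef] at h1 h3 hL
  have hL0 : 0 < L := by linarith
  have heq : limitRatio u = (1 + L) * ((1 - u) * (3 - u)) / (2 * L) := by
    rw [limitRatio, hLdef]
    field_simp
    ring
  rw [heq, le_div_iff₀ (by positivity), div_le_iff₀ (by positivity)]
  constructor
  · have h4 : L ≤ (1 + L) * (1 - u) := by linarith
    nlinarith
  · have h4 : (1 + L) * (1 - u) ≤ 2 * L := by nlinarith
    have h5 : 0 ≤ (1 + L) * (1 - u) := mul_nonneg (by linarith) (by linarith)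
    nlinarith

/-- The squared quotient is a function of α divided by 1 + ε², so the joint limit splits. The
singular factors 1/(α+1) in Σ² and α+1 in the deficit are absorbed into difference quotients tending
to logarithms. -/
lemma tendsto_sigmaConst_mul_deficit {s : ℝ} (hs : 0 < s) {u : ℝ}
    (hu : u = (1 + s / Real.pi)⁻¹) :
    Tendsto (fun p : ℝ × ℝ => sigmaConst 1 p.1 s *
        deficit p.1 (testFun p.1 p.2) (centredDisc s) ^ (1 / 2 : ℝ) / p.2)
      (𝓝[>] (-1) ×ˢ 𝓝[>] 0) (𝓝 (Real.sqrt (limitRatio u))) := by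
  obtain ⟨hu0, hu1⟩ := inv_one_add_mem hs
  rw [← hu] at hu0 hu1
  have hL : Real.log u < 0 := Real.log_neg hu0 hu1
  have hX : Tendsto (fun α : ℝ => 1 + (α + 2) * ((u⁻¹ ^ (α + 1) - 1) / (α + 1))) (𝓝[>] (-1))
      (𝓝 (1 + (-1 + 2) * Real.log u⁻¹)) := by
    have h1 : Tendsto (fun α : ℝ => α + 2) (𝓝[>] (-1)) (𝓝 (-1 + 2)) :=
      ((by fun_prop : Continuous fun α : ℝ => α + 2).tendsto (-1)).mono_left nhdsWithin_le_nhds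
    exact (h1.mul (tendsto_rpow_sub_one_div (inv_pos.2 hu0))).const_add 1
  have hG : Tendsto (fun α : ℝ => u ^ (α + 1) * ((1 - u) * (α + 4 - (α + 2) * u) / 2) /
      (-((u ^ (α + 1) - 1) / (α + 1)))) (𝓝[>] (-1))
      (𝓝 (u ^ (-1 + 1 : ℝ) * ((1 - u) * (-1 + 4 - (-1 + 2) * u) / 2) / (-Real.log u))) := by
    refine Tendsto.div ?_ (tendsto_rpow_sub_one_div hu0).neg (by linarith)
    have hc : Continuous fun α : ℝ =>
        u ^ (α + 1) * ((1 - u) * (α + 4 - (α + 2) * u) / 2) :=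
      (Continuous.rpow continuous_const (by fun_prop) fun _ => Or.inl hu0.ne').mul (by fun_prop)
    exact (hc.tendsto (-1)).mono_left nhdsWithin_le_nhds
  have hε : Tendsto (fun ε : ℝ => 1 + ε ^ 2) (𝓝[>] 0) (𝓝 (1 + 0 ^ 2)) :=
    ((by fun_prop : Continuous fun ε : ℝ => 1 + ε ^ 2).tendsto 0).mono_left nhdsWithin_le_nhds
  have hlim := (((hX.mul hG).comp (tendsto_fst (g := 𝓝[>] (0 : ℝ)))).div
    (hε.comp (tendsto_snd (f := 𝓝[>] (-1 : ℝ)))) (by norm_num)).sqrt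
  have hval : (1 + (-1 + 2) * Real.log u⁻¹) *
      (u ^ (-1 + 1 : ℝ) * ((1 - u) * (-1 + 4 - (-1 + 2) * u) / 2) / (-Real.log u)) /
      (1 + 0 ^ 2) = limitRatio u := by
    rw [limitRatio, Real.log_inv]
    norm_num
    left
    ring
  rw [hval] at hlim
  refine hlim.congr' ?_
  have hα' : ∀ᶠ α in 𝓝[>] (-1 : ℝ), -1 < α := eventually_mem_nhdsWithin
  have hε' : ∀ᶠ ε in 𝓝[>] (0 : ℝ), 0 < ε := eventually_mem_nhdsWithin
  filter_upwards [hα'.prod_mk hε'] with p hp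
  obtain ⟨hα, hε0⟩ := hp
  have a1 : 0 < p.1 + 1 := by linarith
  have hup : u ^ (p.1 + 1) < 1 := Real.rpow_lt_one hu0.le hu1 a1
  have hXnn : 0 ≤ 1 + (p.1 + 2) / (p.1 + 1) * ((1 + 1 * (s / Real.pi)) ^ (p.1 + 1) - 1) := by
    have h1 : 1 ≤ (1 + 1 * (s / Real.pi)) ^ (p.1 + 1) :=
      Real.one_le_rpow (by linarith [div_pos hs Real.pi_pos]) a1.le
    have : 0 ≤ (p.1 + 2) / (p.1 + 1) := div_nonneg (by linarith) a1.le
    nlinarith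
  rw [← Real.sqrt_eq_rpow, sigmaConst, ← Real.sqrt_mul hXnn, eq_div_iff hε0.ne']
  have hsq : ∀ t : ℝ, Real.sqrt t * p.2 = Real.sqrt (t * p.2 ^ 2) := fun t => by
    rw [Real.sqrt_mul' _ (sq_nonneg _), Real.sqrt_sq hε0.le]
  rw [hsq, deficit_testFun_centredDisc hα p.2 hs hu]
  have hσ : 1 + 1 * (s / Real.pi) = u⁻¹ := by rw [hu, inv_inv, one_mul]
  rw [hσ]
  congr 1
  have e1 : 1 - u ^ (p.1 + 1) ≠ 0 := by linarith
  have e2 : -((u ^ (p.1 + 1) - 1) / (p.1 + 1)) = (1 - u ^ (p.1 + 1)) / (p.1 + 1) := by ring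
  simp only [Pi.div_apply, Function.comp_apply, e2]
  field_simp

end SmallWeight

end BergmanStability

end

open BergmanStability in
theorem mainTheorem5 :
    -- (i) the exponent `1/2` is optimal in both estimates
    (∀ α : ℝ, -1 < α → ∀ β : ℝ, 1 / 2 < β → ∀ s : ℝ, 0 < s →
      (¬ ∃ K : ℝ, FunctionEstimate α s K β) ∧ (¬ ∃ K : ℝ, SetEstimate α s K β)) ∧
    -- (ii) dependence of the constant on `s`, for large `α` and for each `α`
    (∀ c : ℝ, c < 1 → ∀ C : ℝ,
      ¬ ∀ᶠ α : ℝ in Filter.atTop, ∀ s : ℝ, 0 < s →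
        FunctionEstimate α s (C * sigmaConst c α s) (1 / 2)) ∧
    (∀ α : ℝ, -1 < α → ∀ c C : ℝ, 0 < C →
      (∀ s : ℝ, 0 < s → FunctionEstimate α s (C * sigmaConst c α s) (1 / 2)) →
        (C ^ 2 * (α + 2) / 2) ^ (-(1 / (α + 1))) ≤ c) ∧
    (∀ α : ℝ, -1 < α → ∀ c : ℝ,
      (∀ s : ℝ, 0 < s → FunctionEstimate α s (sigmaConst c α s) (1 / 2)) →
        (Real.pi * (α + 2) / (α + 1)) ^ (-(1 / (α + 1))) ≤ c) ∧
    -- (iii) sharpness as `α → -1`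
    (∃ a b : ℝ, 0 < a ∧ ∀ s : ℝ, 0 < s →
      hypMeasure (centredDisc s) = ENNReal.ofReal s ∧
      (∀ α ε : ℝ, -1 < α → MemBergman α (testFun α ε) ∧ 0 < bergmanNorm α (testFun α ε)) ∧
      Filter.Tendsto (fun p : ℝ × ℝ => extremalDist p.1 (testFun p.1 p.2) / p.2)
        (nhdsWithin (-1) (Set.Ioi (-1)) ×ˢ nhdsWithin 0 (Set.Ioi 0)) (nhds 1) ∧
      ∃ κ : ℝ, a ≤ κ ∧ κ ≤ b ∧
        Filter.Tendsto (fun p : ℝ × ℝ => sigmaConst 1 p.1 s *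
            deficit p.1 (testFun p.1 p.2) (centredDisc s) ^ (1 / 2 : ℝ) / p.2)
          (nhdsWithin (-1) (Set.Ioi (-1)) ×ˢ nhdsWithin 0 (Set.Ioi 0)) (nhds κ)) := by
  refine ⟨fun α hα β hβ s hs => ⟨not_functionEstimate hα hβ hs, not_setEstimate hα hβ hs⟩,
    fun c hc C => not_eventually_estimate hc C, fun α hα c C hC h => ?_,
    fun α hα c h => ?_,
    -- Square roots of the bounds in `limitRatio_mem`.
    1, Real.sqrt 3, one_pos, fun s hs => ⟨hypMeasure_centredDisc hs,
      fun α ε hα => ⟨memBergman_testFun hα ε, bergmanNorm_testFun_pos hα ε⟩,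
      tendsto_extremalDist_div, ?_⟩⟩
  · obtain ⟨hc, h1⟩ := one_le_of_estimate hα h
    have : 0 < α + 2 := by linarith
    exact rpow_neg_inv_le_of_one_le_mul (by positivity) hc (by linarith) h1
  · -- For `α + 1 ≤ 2π` this is the preceding bound with `C = 1`; for larger `α` the constant
    -- `C = 1` is not admissible.
    rcases le_or_gt (α + 1) (2 * Real.pi) with hle | -
    · obtain ⟨hc, h1⟩ := one_le_of_estimate (C := 1) hα (by simpa using h)
      have hpi := Real.pi_pos
      have a1 : 0 < α + 1 := by linarith
      have a2 : 0 < α + 2 := by linarith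
      refine rpow_neg_inv_le_of_one_le_mul (by positivity) hc a1 (h1.trans ?_)
      refine mul_le_mul_of_nonneg_right ?_ (Real.rpow_nonneg hc _)
      rw [div_le_div_iff₀ two_pos a1]
      nlinarith
    · exact absurd h (not_estimate_one hα c)
  · obtain ⟨hu0, hu1⟩ := inv_one_add_mem hs
    obtain ⟨h1, h2⟩ := limitRatio_mem hu0 hu1
    exact ⟨_, Real.one_le_sqrt.2 h1, Real.sqrt_le_sqrt h2, tendsto_sigmaConst_mul_deficit hs rfl⟩
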